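/- **Setting.** There are $n$ nodes; node $i$ holds a data item $d_i$ from a totally ordered set, and at any time the items of the nodes are pairwise distinct. The rank of $d_i$ is its position among the current items, sorted increasingly. Fix $\varphi\in(0,1)$ and a constant $\kappa>0$. Write $\log=\log_2$, $\mathfrak h=\log_{1/\varphi}\log n$ and $h_{\max}=\lceil\log_{1/\varphi} n\rceil$. To *draw a height* means to draw $\min\{h,h_{\max}\}$ with $\Pr[h=j]=\varphi^{j-1}(1-\varphi)$ for $j\ge 1$, independently of everything else. A rank $k$ is in class $\ell$ if $\log^{8\kappa\ell}n\le k<\log^{8\kappa(\ell+1)}n$. The classes $0,\dots,K-1$, $K=\lfloor \log n/(8\kappa\log\log n)\rfloor$, are those lying completely below $n$; "class" below means one of these. **Data structure.** Every node $i$ has a height $h_i$, and the server stores a set $DS$ of pairs $(h_i,d_i)$. For $\tau\in\{0,1,2,3\}$, $S_{\ell,\tau}$ is the set of stored pairs with $h_i\in((8\ell+2\tau+1)\kappa\mathfrak h,(8\ell+2\tau+3)\kappa\mathfrak h]$, and $S_\ell=\bigcup_\tau S_{\ell,\tau}$. Class $\ell$ is *filled* if $S_{\ell,1}\ne\emptyset\ne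 S_{\ell,2}$. A class may have an alarm $a_\ell$ and a representative $r_\ell$, which are stored items. The operations are: * INITIALIZE on a set $A$ of nodes: the stored pairs of nodes of $A$ are discarded, and those of the other nodes stay. The nodes of $A$ draw new heights. Then the server sets $d_{\min}=\infty$ and, for $h=h_{\max},h_{\max}-1,\dots,1$, probes all $i\in A$ with $h_i=h$ and $d_i<d_{\min}$; if there is a response, it stores the pair of the smallest response and sets $d_{\min}$ to this item. This is repeated (from the same starting configuration, with fresh randomness) until all classes are filled. Finally every class whose previous alarm and representative both exist and are held by nodes outside $A$ keeps them; for every other class $a_\ell\in S_{\ell,1}$ and $r_\ell\in S_{\ell,2}$ are chosen uniformly and independently at random. INITIALIZE without further specification starts from an empty $DS$ and uses all nodes. * UPDATE$(i,d)$: the item of node $i$ is replaced by $d$, its pair (if stored) is deleted from $DS$, and node $i$ draws a new height $h_i$. For each class $\ell$ such that the old item of node $i$ was $a_\ell$ or $r_\ell$, or such that $h_i\in[h(a_\ell),h(r_\ell)]$ and $d<a_\ell$ (where $h(\cdot)$ is the height of the node holding the item), all pairs of $S_\ell$ are deleted, and with them $a_\ell$ and $r_\ell$. * REFRESH: let $\ell_1\ge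 0$ be the least level such that all classes above $\ell_1$ are filled; let $\ell_2$ be the level with $h\in(8\ell_2\kappa\mathfrak h,8(\ell_2+1)\kappa\mathfrak h]$, where $h$ is the largest height of a node that observed an UPDATE since the last INITIALIZE or REFRESH ($\ell_2=0$ if there is none); let $\ell=\max\{\ell_1,\ell_2\}$. Run INITIALIZE on the nodes $i$ with $d_i<r_{\ell'}$, where $\ell'\ge\ell$ is the least class that has a representative (on all nodes if there is none). * ROUGH-RANK$(k)$ returns $r_{\ell+1}$ for the $\ell$ such that $k$ is in class $\ell$. The data structure has the *Rough Rank Sketch property with exponent $c$* if for every rank $k\ge 1$ with $k\log^c n\le n$ the query ROUGH-RANK$(k)$ returns an item that is stored in $DS$ and whose current rank is in $[k,k\log^c n]$. **Theorem.** For every $c'>0$ there is $\kappa_0>0$ such that for every $\kappa\ge\kappa_0$ there is a constant $c>0$ such that for every $\varphi\in(0,1)$ and all sufficiently large $n$ the following holds. Take any initial items, any number $T\le\log n$, and for each $t=1,\dots,T$ any finite sequence of any number $m_t$ of UPDATEs, all fixed in advance, i.e. independently of the random choices of the algorithm. Execute INITIALIZE and then, for $t=1,\dots,T$, the $t$-th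 sequence of UPDATEs followed by a REFRESH. Then with probability at least $1-\log^{-c'}(n)$ all operations terminate and the data structure has the Rough Rank Sketch property with exponent $c$ after the last REFRESH (after INITIALIZE if $T=0$). In particular, for all these ranks $k$ simultaneously, $DS$ contains an item of rank in $[k,k\log^c n]$. -/

import Mathlib

open scoped ENNReal

universe u

namespace SeleMon

noncomputable section

/-! ### Probabilistic building blocks -/

/-- The joint law of independent random variables `X i` with laws `p i`. -/
def independentPMF {ι : Type*} {α : ι → Type*} [Fintype ι] [DecidableEq ι]
    [∀ i, Fintype (α i)] (p : ∀ i, PMF (α i)) : PMF (∀ i, α i) :=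
  PMF.ofFintype (fun f => ∏ i, p i (f i)) (by
    have h1 : ∀ i, ∑ a, p i a = 1 := fun i => by
      rw [← tsum_fintype (L := .unconditional _)]
      exact (p i).tsum_coe
    rw [← Fintype.piFinset_univ, ← Finset.prod_univ_sum]
    simp [h1])

open Classical in
/-- The law of "sample from `p`, independently, until the sample satisfies `good`": the law of `p`
conditioned on `good`. The outcome `none` means that the loop never ends. -/
def repeatUntil {α : Type*} (p : PMF α) (good : α → Prop) : PMF (Option α) :=
  if h : ∃ a ∈ {a | good a}, a ∈ p.support then (p.filter {a | good a} h).map some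
  else PMF.pure none

open Classical in
/-- A uniformly random element of `S` (and `none` if `S` is empty). -/
def pick {α : Type*} (S : Finset α) : PMF (Option α) :=
  if h : S.Nonempty then (PMF.uniformOfFinset S h).map some else PMF.pure none

/-- Run a randomized procedure after one that possibly did not terminate. -/
def andThen {α β : Type*} (p : PMF (Option α)) (f : α → PMF (Option β)) : PMF (Option β) :=
  p.bind fun o => match o with
    | none => PMF.pure none
    | some a => f a

/-! ### Parameters, heights and classes -/

/-- The number `n` of nodes, the failure probability `φ` of the geometric distribution, and the
constant `con` that fixes the granularity of the classes. -/
structure Params where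
  n : ℕ
  φ : ℝ
  φ_pos : 0 < φ
  φ_lt_one : φ < 1
  con : ℝ

/-- `log n`, to base two. -/
def Params.L (P : Params) : ℝ := Real.logb 2 P.n

/-- `𝔥 = log_{1/φ} (log n)`, so that `φ ^ 𝔥 = 1 / log n`. -/
def Params.hUnit (P : Params) : ℝ := Real.logb (1 / P.φ) P.L

/-- `h_max = log_{1/φ} n`, rounded up. -/
def Params.hmax (P : Params) : ℕ := ⌈Real.logb (1 / P.φ) P.n⌉₊

/-- Heights, capped at `h_max`. -/
abbrev Params.Height (P : Params) : Type := Fin (P.hmax + 1)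

/-- The law of `min {h, h_max}` where `Pr[h = j] = φ ^ (j - 1) * (1 - φ)` for `j ≥ 1`
(Mathlib's geometric distribution starts at `0`). -/
def Params.heightLaw (P : Params) : PMF P.Height :=
  (ProbabilityTheory.geometricMeasure
    ⟨1 - P.φ, by linarith [P.φ_lt_one], by linarith [P.φ_pos]⟩).toPMF.map
    fun x => ⟨min (x + 1) P.hmax, Nat.lt_succ_of_le (min_le_right _ _)⟩

/-- The rank `k` lies in class `ℓ`, i.e. in `[log^{8 con ℓ} n, log^{8 con (ℓ + 1)} n)`. -/
def Params.RankInClass (P : Params) (ℓ k : ℕ) : Prop :=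
  P.L ^ (8 * P.con * ℓ) ≤ (k : ℝ) ∧ (k : ℝ) < P.L ^ (8 * P.con * (ℓ + 1))

/-- The number of complete classes: the number of `ℓ` with `log^{8 con (ℓ + 1)} n ≤ n`. -/
def Params.K (P : Params) : ℕ := ⌊P.L / (8 * P.con * Real.logb 2 P.L)⌋₊

/-- The height `h` lies in `h(C_{ℓ,τ})`. -/
def Params.InSub (P : Params) (ℓ τ h : ℕ) : Prop :=
  (8 * ℓ + (2 * τ + 1)) * P.con * P.hUnit < (h : ℝ) ∧
    (h : ℝ) ≤ (8 * ℓ + (2 * τ + 3)) * P.con * P.hUnit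

/-- The class `ℓ` with `h ∈ h(C_ℓ) = (8 con ℓ 𝔥, 8 con (ℓ + 1) 𝔥]`. -/
def Params.levelOfHeight (P : Params) (h : ℕ) : ℕ := ⌈(h : ℝ) / (8 * P.con * P.hUnit)⌉₊ - 1

/-! ### The rank of an item and the sweep of `ConstantFactorSelect` -/

open Classical in
/-- The position of the item of node `i` in the sorted order of the current items. -/
def rank {D : Type u} [LinearOrder D] {n : ℕ} (item : Fin n → D) (i : Fin n) : ℕ :=
  (Finset.univ.filter fun j => item j ≤ item i).card

open Classical in
/-- The loop of `ConstantFactorSelect` over the heights `h, h - 1, …, 1`, run on the nodes of `A`.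
At each height the server probes all nodes of this height whose item is smaller than `dmin`, keeps
the node of the smallest response, and lowers `dmin` to this response. -/
def sweep {D : Type u} [LinearOrder D] {n : ℕ} (item : Fin n → D) (height : Fin n → ℕ)
    (A : Finset (Fin n)) : ℕ → WithTop D → Finset (Fin n)
  | 0, _ => ∅
  | h + 1, dmin =>
    let responses := A.filter fun i => height i = h + 1 ∧ (item i : WithTop D) < dmin
    (responses.filter fun i => ∀ j ∈ responses, item i ≤ item j) ∪
      sweep item height A h (min dmin (responses.inf fun i => (item i : WithTop D)))

/-! ### The data structure and its operations -/

/-- A configuration of nodes and server. -/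
structure State (P : Params) (D : Type u) where
  /-- the current data item of each node -/
  item : Fin P.n → D
  /-- the current height of each node -/
  height : Fin P.n → P.Height
  /-- the nodes `i` whose pair `(h_i, d_i)` is in `DS` -/
  stored : Finset (Fin P.n)
  /-- the node holding the alarm `a_ℓ` of class `ℓ` -/
  alarm : Fin P.K → Option (Fin P.n)
  /-- the node holding the representative `r_ℓ` of class `ℓ` -/
  rep : Fin P.K → Option (Fin P.n)
  /-- the nodes that observed an UPDATE since the last INITIALIZE or REFRESH -/
  touched : Finset (Fin P.n)

variable {P : Params} {D : Type u} [LinearOrder D]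

open Classical in
/-- `S_{ℓ,τ}`: the stored nodes with height in `h(C_{ℓ,τ})`. -/
def sub (stored : Finset (Fin P.n)) (height : Fin P.n → P.Height) (ℓ τ : ℕ) : Finset (Fin P.n) :=
  stored.filter fun i => P.InSub ℓ τ (height i)

/-- Class `ℓ` is filled: both `S_{ℓ,1}` and `S_{ℓ,2}` are non-empty. -/
def Filled (stored : Finset (Fin P.n)) (height : Fin P.n → P.Height) (ℓ : ℕ) : Prop :=
  (sub stored height ℓ 1).Nonempty ∧ (sub stored height ℓ 2).Nonempty

open Classical in
/-- The contents of `DS` once the nodes of `A` have heights `height` and have been swept; pairs of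
nodes outside `A` stay. -/
def storedAfterSweep (s : State P D) (A : Finset (Fin P.n)) (height : Fin P.n → P.Height) :
    Finset (Fin P.n) :=
  (s.stored \ A) ∪ sweep s.item (fun i => (height i : ℕ)) A P.hmax ⊤

/-- Class `ℓ` still has an alarm and a representative, both outside `A`. -/
def Keeps (s : State P D) (A : Finset (Fin P.n)) (ℓ : Fin P.K) : Prop :=
  ∃ a r, s.alarm ℓ = some a ∧ s.rep ℓ = some r ∧ a ∉ A ∧ r ∉ A

open Classical in
/-- INITIALIZE on the nodes of `A`. These nodes draw new heights and are swept, again and again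
until all classes are filled. Then alarms and representatives are drawn uniformly and independently
for the classes that do not keep theirs. -/
def initOn (s : State P D) (A : Finset (Fin P.n)) : PMF (Option (State P D)) :=
  andThen
    (repeatUntil
      (independentPMF fun i => if i ∈ A then P.heightLaw else PMF.pure (s.height i))
      fun height => ∀ ℓ : Fin P.K, Filled (storedAfterSweep s A height) height ℓ)
    fun height =>
      let stored := storedAfterSweep s A height
      (independentPMF fun ℓ : Fin P.K =>
          if Keeps s A ℓ then PMF.pure (s.alarm ℓ) else pick (sub stored height ℓ 1)).bind
        fun alarm =>
          (independentPMF fun ℓ : Fin P.K =>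
              if Keeps s A ℓ then PMF.pure (s.rep ℓ) else pick (sub stored height ℓ 2)).map
            fun rep => some
              { item := s.item, height := height, stored := stored, alarm := alarm, rep := rep,
                touched := ∅ }

/-- INITIALIZE() when the nodes observe the items `item`: start from the empty data structure and
let all nodes take part. -/
def initAll (item : Fin P.n → D) : PMF (Option (State P D)) :=
  initOn
    { item := item, height := fun _ => 0, stored := ∅, alarm := fun _ => none,
      rep := fun _ => none, touched := ∅ }
    Finset.univ

/-- The UPDATE by which node `i` gets the item `d` and the fresh height `h` makes class `ℓ` invalid:
the old item was the alarm or the representative of the class, or the new item is smaller than the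
alarm and its height lies between the heights of alarm and representative. -/
def Fires (s : State P D) (i : Fin P.n) (d : D) (h : P.Height) (ℓ : Fin P.K) : Prop :=
  s.alarm ℓ = some i ∨ s.rep ℓ = some i ∨
    ∃ a r, s.alarm ℓ = some a ∧ s.rep ℓ = some r ∧
      s.height a ≤ h ∧ h ≤ s.height r ∧ d < s.item a

open Classical in
/-- UPDATE`(i, d)`. If class `ℓ` becomes invalid then all pairs of
`S_ℓ = S_{ℓ,0} ∪ … ∪ S_{ℓ,3}` are deleted, among them its alarm and its representative. -/
def update (s : State P D) (i : Fin P.n) (d : D) : PMF (State P D) :=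
  P.heightLaw.map fun h =>
    { item := Function.update s.item i d
      height := Function.update s.height i h
      stored := (s.stored.erase i).filter fun j =>
        ∀ ℓ : Fin P.K, Fires s i d h ℓ → ∀ τ ∈ Finset.range 4, j ∉ sub s.stored s.height ℓ τ
      alarm := fun ℓ => if Fires s i d h ℓ then none else s.alarm ℓ
      rep := fun ℓ => if Fires s i d h ℓ then none else s.rep ℓ
      touched := insert i s.touched }

open Classical in
/-- The level determined by REFRESH: the maximum of the least `ℓ` such that all classes above `ℓ`
are filled and of the level of the maximal height of a node that observed an UPDATE. -/
def refreshLevel (s : State P D) : ℕ :=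
  max (((Finset.range P.K).filter fun ℓ => ¬ Filled s.stored s.height ℓ).sup id)
    (P.levelOfHeight (s.touched.sup fun i => (s.height i : ℕ)))

/-- The representative of the lowest class `≥ ℓ` that has one. -/
def lowestRep (s : State P D) (ℓ : ℕ) : Option (Fin P.n) :=
  ((List.finRange P.K).filter fun ℓ' => ℓ ≤ ℓ'.val).findSome? s.rep

open Classical in
/-- The nodes that REFRESH restricts INITIALIZE to: those with an item smaller than `r_ℓ`, where
`ℓ` is the level that REFRESH determined. If class `ℓ` lost its representative, the next class above
that has one replaces it; if there is none, all nodes take part. -/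
def refreshNodes (s : State P D) : Finset (Fin P.n) :=
  match lowestRep s (refreshLevel s) with
  | none => Finset.univ
  | some r => Finset.univ.filter fun i => s.item i < s.item r

/-- REFRESH(). -/
def refresh (s : State P D) : PMF (Option (State P D)) := initOn s (refreshNodes s)

/-- A sequence of UPDATEs. -/
def updates (s : State P D) : List (Fin P.n × D) → PMF (State P D)
  | [] => PMF.pure s
  | u :: us => (update s u.1 u.2).bind fun s' => updates s' us

/-- For each list in turn, execute its UPDATEs and then a REFRESH. -/
def rounds (s : State P D) : List (List (Fin P.n × D)) → PMF (Option (State P D))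
  | [] => PMF.pure (some s)
  | us :: rest => andThen ((updates s us).bind refresh) fun s' => rounds s' rest

/-- INITIALIZE, followed by the given rounds of UPDATEs, each of them closed by a REFRESH. -/
def run (item : Fin P.n → D) (us : List (List (Fin P.n × D))) : PMF (Option (State P D)) :=
  andThen (initAll item) fun s => rounds s us

/-- ROUGH-RANK`(k)` returns the item of node `i`: it is `r_{ℓ + 1}`, where `k` is in class `ℓ`. -/
def RoughRankReturns (s : State P D) (k : ℕ) (i : Fin P.n) : Prop :=
  ∃ (ℓ : ℕ) (ℓ' : Fin P.K), P.RankInClass ℓ k ∧ ℓ'.val = ℓ + 1 ∧ s.rep ℓ' = some i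

/-- The Rough Rank Sketch property with exponent `c`: for every rank `k` for which
`[k, k * log^c n]` is a range of ranks, ROUGH-RANK`(k)` returns an item that is stored in `DS` and
whose current rank lies in this range. -/
def RoughRankSketch (s : State P D) (c : ℝ) : Prop :=
  ∀ k : ℕ, 1 ≤ k → (k : ℝ) * P.L ^ c ≤ P.n →
    ∃ i ∈ s.stored, RoughRankReturns s k i ∧
      k ≤ rank s.item i ∧ (rank s.item i : ℝ) ≤ k * P.L ^ c

/-- The items that the nodes hold after the given UPDATEs. -/
def itemsAfter {n : ℕ} (item : Fin n → D) (us : List (Fin n × D)) : Fin n → D :=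
  us.foldl (fun f u => Function.update f u.1 u.2) item

/-- At all times the items of the nodes are pairwise distinct. -/
def AlwaysDistinct {n : ℕ} (item : Fin n → D) (us : List (List (Fin n × D))) : Prop :=
  ∀ vs, vs <+: us.flatten → Function.Injective (itemsAfter item vs)

end

end SeleMon

/-!
# Rough ranks survive logarithmically many rounds of oblivious UPDATEs

Measured in powers of `log n`, the node with the smallest item among those of height above
`m * con * 𝔥` has rank about `log^{m * con} n`. Two kinds of events make this precise. Heights are
*sparse* (`SparseOn`) if no node of rank at most `log^{m * con - x} n` is higher than
`m * con * 𝔥`, and *tall* (`Tall`) if certain sets of at least `log^{m * con + x} n` nodes contain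
a node higher than that. Both concern sets of nodes that are fixed before the heights in question
are drawn, so that a union bound suffices (`fresh_fail_le`). As the UPDATEs are oblivious, the item
assignments at the ends of all rounds (`futures`) are known in advance, and sparseness is demanded
for all of them at the moment a height is drawn; this avoids conditioning on heights that survive a
REFRESH.

The invariant at the end of a round (`Sound`) says that the heights are sparse, that the stored
nodes of class `ℓ` have ranks at most `log^{8 (ℓ + 1) con + O(x)} n`, and that every class has a
representative. It is preserved for the following reasons.

* The largest updated height bounds the number of updated nodes (`Pending.card_le_size`), so that
  ranks in the classes at or above the level of REFRESH grow by a small amount only; over at most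
  `log n` rounds these amounts add up to a factor `O(log n)`.
* By the bounds on ranks, stored nodes of lower classes have smaller items than those of higher
  classes (`Pending.item_lt`). Hence the nodes that REFRESH selects, those below some
  representative `r_{ℓ'}`, comprise all stored nodes of the classes below `ℓ'` and none of the
  nodes that fill the classes above `ℓ'`.
* As `r_{ℓ'}` is high, its rank is large, and so many nodes draw new heights that the sweep fills
  all remaining classes (`exists_mem_sweep`) with nodes of small ranks (`rank_le_of_mem_sweep`).
  In particular the repetition in INITIALIZE succeeds with probability at least `1 / 2` each time,
  and conditioning on success at most doubles the probability of failure (`repeatUntil_fail_le`).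

The deletions caused by alarms only have to leave representatives and their pairs consistent
(`RepStored`). Finally, `FinallySound.roughRankSketch` reads off the sketch property from the
invariant.
-/

namespace SeleMon

noncomputable section

/-! ### Probabilities of events -/

lemma toOuterMeasure_add_compl {α : Type*} (p : PMF α) (S : Set α) :
    p.toOuterMeasure S + p.toOuterMeasure Sᶜ = 1 := by
  rw [PMF.toOuterMeasure_apply, PMF.toOuterMeasure_apply, ← ENNReal.tsum_add, ← p.tsum_coe]
  exact tsum_congr fun a => congrFun (Set.indicator_self_add_compl S p) a

lemma toOuterMeasure_le_one {α : Type*} (p : PMF α) (S : Set α) : p.toOuterMeasure S ≤ 1 :=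
  (toOuterMeasure_add_compl p S) ▸ le_self_add

lemma toOuterMeasure_mono_of_support {α : Type*} (p : PMF α) {S T : Set α}
    (h : ∀ a ∈ p.support, a ∈ S → a ∈ T) : p.toOuterMeasure S ≤ p.toOuterMeasure T :=
  PMF.toOuterMeasure_mono p fun a ha => h a ha.2 ha.1

lemma toOuterMeasure_eq_zero_of_support {α : Type*} (p : PMF α) {S : Set α}
    (h : ∀ a ∈ p.support, a ∉ S) : p.toOuterMeasure S = 0 :=
  (PMF.toOuterMeasure_apply_eq_zero_iff p S).2 (Set.disjoint_left.2 h)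

/-- Union bound for two consecutive steps: the first one misses `G` with probability at most `ε₁`,
and from every outcome in `G` the second one ends in `S` with probability at most `ε₂`. -/
lemma toOuterMeasure_bind_le {α β : Type*} (p : PMF α) (f : α → PMF β) (G : Set α) (S : Set β)
    {ε₁ ε₂ : ℝ≥0∞} (h₁ : p.toOuterMeasure Gᶜ ≤ ε₁)
    (h₂ : ∀ a ∈ p.support, a ∈ G → (f a).toOuterMeasure S ≤ ε₂) :
    (p.bind f).toOuterMeasure S ≤ ε₁ + ε₂ := by
  classical
  rw [PMF.toOuterMeasure_bind_apply]
  calc ∑' a, p a * (f a).toOuterMeasure S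
      ≤ ∑' a, (Gᶜ.indicator p a + p a * ε₂) := by
        refine ENNReal.tsum_le_tsum fun a => ?_
        by_cases ha : a ∈ p.support
        · by_cases hG : a ∈ G
          · exact le_add_left (mul_le_mul_right (h₂ a ha hG) _)
          · rw [Set.indicator_of_mem (by exact hG)]
            exact le_add_right (mul_le_of_le_one_right' (toOuterMeasure_le_one _ _))
        · rw [PMF.mem_support_iff, not_not] at ha
          simp [ha]
    _ = p.toOuterMeasure Gᶜ + ε₂ := by
        rw [ENNReal.tsum_add, ENNReal.tsum_mul_right, p.tsum_coe, one_mul,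
          PMF.toOuterMeasure_apply]
    _ ≤ ε₁ + ε₂ := by gcongr

/-- Conditioning on an event of probability at least `1 / 2` at most doubles the probability of
failure. -/
lemma repeatUntil_fail_le {α : Type*} (p : PMF α) (good : α → Prop) (E : Set α) {ε : ℝ≥0∞}
    (hε : ε ≤ 2⁻¹) (hE : p.toOuterMeasure Eᶜ ≤ ε) (hgood : ∀ a ∈ p.support, a ∈ E → good a) :
    (repeatUntil p good).toOuterMeasure {o | ∃ a ∈ p.support, o = some a ∧ good a ∧ a ∈ E}ᶜ
      ≤ 2 * ε := by
  classical
  have hhalf : (2 : ℝ≥0∞)⁻¹ ≤ p.toOuterMeasure {a | good a} := by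
    have h1 : p.toOuterMeasure E ≤ p.toOuterMeasure {a | good a} :=
      toOuterMeasure_mono_of_support p hgood
    have h2 := toOuterMeasure_add_compl p E
    have h3 : (1 : ℝ≥0∞) ≤ p.toOuterMeasure E + 2⁻¹ := by
      rw [← h2]; gcongr; exact hE.trans hε
    have h4 : (2 : ℝ≥0∞)⁻¹ + 2⁻¹ ≤ p.toOuterMeasure E + 2⁻¹ := by
      rwa [ENNReal.inv_two_add_inv_two]
    exact ((ENNReal.add_le_add_iff_right (by simp)).1 h4).trans h1
  have hex : ∃ a ∈ {a | good a}, a ∈ p.support := by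
    by_contra hcon
    push Not at hcon
    have : p.toOuterMeasure {a | good a} = 0 :=
      toOuterMeasure_eq_zero_of_support p fun a ha hg => hcon a hg ha
    rw [this] at hhalf
    simp at hhalf
  rw [repeatUntil, dif_pos hex, PMF.toOuterMeasure_map_apply]
  have hsub : (p.filter {a | good a} hex).toOuterMeasure
      (some ⁻¹' {o | ∃ a ∈ p.support, o = some a ∧ good a ∧ a ∈ E}ᶜ)
      ≤ (p.filter {a | good a} hex).toOuterMeasure Eᶜ := by
    refine toOuterMeasure_mono_of_support _ fun a ha h hE' => h ?_
    rw [PMF.mem_support_filter_iff] at ha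
    exact ⟨a, ha.2, rfl, ha.1, hE'⟩
  refine hsub.trans ?_
  rw [PMF.toOuterMeasure_apply]
  calc ∑' a, Eᶜ.indicator (p.filter {a | good a} hex) a
      ≤ ∑' a, Eᶜ.indicator p a * (p.toOuterMeasure {a | good a})⁻¹ := by
        refine ENNReal.tsum_le_tsum fun a => ?_
        by_cases ha : a ∈ Eᶜ
        · rw [Set.indicator_of_mem ha, Set.indicator_of_mem ha, PMF.filter_apply,
            ← PMF.toOuterMeasure_apply]
          gcongr
          exact Set.indicator_le_self _ _ _
        · rw [Set.indicator_of_notMem ha]; exact zero_le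
    _ = p.toOuterMeasure Eᶜ * (p.toOuterMeasure {a | good a})⁻¹ := by
        rw [ENNReal.tsum_mul_right, PMF.toOuterMeasure_apply p Eᶜ]
    _ ≤ ε * (2⁻¹)⁻¹ := by gcongr
    _ = 2 * ε := by rw [inv_inv, mul_comm]

lemma independentPMF_apply {ι : Type*} {α : ι → Type*} [Fintype ι] [DecidableEq ι]
    [∀ i, Fintype (α i)] (p : ∀ i, PMF (α i)) (f : ∀ i, α i) :
    independentPMF p f = ∏ i, p i (f i) := rfl

lemma mem_support_independentPMF {ι : Type*} {α : ι → Type*} [Fintype ι] [DecidableEq ι]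
    [∀ i, Fintype (α i)] (p : ∀ i, PMF (α i)) {f : ∀ i, α i}
    (hf : f ∈ (independentPMF p).support) (i : ι) : f i ∈ (p i).support := by
  rw [PMF.mem_support_iff, independentPMF_apply] at hf
  exact (PMF.mem_support_iff _ _).2 (Finset.prod_ne_zero_iff.1 hf i (Finset.mem_univ i))

lemma toOuterMeasure_independentPMF_pi {ι : Type*} {α : ι → Type*} [Fintype ι] [DecidableEq ι]
    [∀ i, Fintype (α i)] (p : ∀ i, PMF (α i)) (S : ∀ i, Set (α i)) :
    (independentPMF p).toOuterMeasure {f | ∀ i, f i ∈ S i} = ∏ i, (p i).toOuterMeasure (S i) := by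
  classical
  simp only [PMF.toOuterMeasure_apply_fintype]
  rw [Finset.prod_univ_sum, Fintype.piFinset_univ]
  refine Finset.sum_congr rfl fun f _ => ?_
  by_cases hf : f ∈ {f : ∀ i, α i | ∀ i, f i ∈ S i}
  · rw [Set.indicator_of_mem hf, independentPMF_apply]
    exact Finset.prod_congr rfl fun i _ => (Set.indicator_of_mem (hf i) _).symm
  · rw [Set.indicator_of_notMem hf]
    obtain ⟨i, hi⟩ := not_forall.1 hf
    exact (Finset.prod_eq_zero (Finset.mem_univ i) (Set.indicator_of_notMem hi _)).symm

lemma mem_support_pick {α : Type*} {S : Finset α} (hS : S.Nonempty) {o : Option α}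
    (ho : o ∈ (pick S).support) : ∃ a ∈ S, o = some a := by
  rw [pick, dif_pos hS, PMF.mem_support_map_iff] at ho
  obtain ⟨a, ha, rfl⟩ := ho
  exact ⟨a, (PMF.mem_support_uniformOfFinset_iff hS a).1 ha, rfl⟩

/-! ### The law of the heights -/

section HeightLaw

lemma geometric_toOuterMeasure_range (φ : ℝ) (h₀ : 0 < φ) (h₁ : φ < 1) (m : ℕ) :
    (ProbabilityTheory.geometricMeasure
      ⟨1 - φ, by linarith, by linarith⟩).toPMF.toOuterMeasure (Finset.range m : Set ℕ)
      = ENNReal.ofReal (1 - φ ^ m) := by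
  have hp : (⟨1 - φ, by linarith, by linarith⟩ : unitInterval) ≠ 0 := by
    intro h
    have := congrArg Subtype.val h
    simp only [Set.Icc.coe_zero] at this
    linarith
  have hs : ∀ x : ℕ, (0 : ℝ) ≤ φ ^ x * (1 - φ) := fun x =>
    mul_nonneg (pow_nonneg h₀.le x) (by linarith)
  rw [PMF.toOuterMeasure_apply_finset]
  have hterm : ∀ x : ℕ, (ProbabilityTheory.geometricMeasure
      ⟨1 - φ, by linarith, by linarith⟩).toPMF x = ENNReal.ofReal (φ ^ x * (1 - φ)) := by
    intro x
    rw [MeasureTheory.Measure.toPMF_apply, ProbabilityTheory.geometricMeasure_singleton hp]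
    simp
  simp only [hterm]
  rw [← ENNReal.ofReal_sum_of_nonneg fun x _ => hs x, ← Finset.sum_mul, geom_sum_mul_neg]

variable {P : Params}

lemma heightLaw_le_threshold {θ : ℝ} (h₀ : 0 ≤ θ) (h : θ < P.hmax) :
    P.heightLaw.toOuterMeasure {g | ¬ θ < ((g : ℕ) : ℝ)}
      = ENNReal.ofReal (1 - P.φ ^ ⌊θ⌋₊) := by
  rw [Params.heightLaw, PMF.toOuterMeasure_map_apply,
    ← geometric_toOuterMeasure_range P.φ P.φ_pos P.φ_lt_one]
  congr 1
  ext x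
  simp only [Set.mem_preimage, Set.mem_ofPred_eq, Finset.coe_range, Set.mem_Iio]
  rw [← Nat.floor_lt h₀] at h ⊢
  omega

lemma heightLaw_gt_threshold_le {θ : ℝ} (h₀ : 0 ≤ θ) :
    P.heightLaw.toOuterMeasure {g | θ < ((g : ℕ) : ℝ)} ≤ ENNReal.ofReal (P.φ ^ ⌊θ⌋₊) := by
  by_cases h : θ < P.hmax
  · have h1 := toOuterMeasure_add_compl P.heightLaw {g | θ < ((g : ℕ) : ℝ)}
    rw [show ({g : P.Height | θ < ((g : ℕ) : ℝ)})ᶜ = {g : P.Height | ¬ θ < ((g : ℕ) : ℝ)} from rfl,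
      heightLaw_le_threshold h₀ h] at h1
    have hle : P.φ ^ ⌊θ⌋₊ ≤ 1 := pow_le_one₀ P.φ_pos.le P.φ_lt_one.le
    have h2 : ENNReal.ofReal (P.φ ^ ⌊θ⌋₊) + ENNReal.ofReal (1 - P.φ ^ ⌊θ⌋₊) = 1 := by
      rw [← ENNReal.ofReal_add (pow_nonneg P.φ_pos.le _) (by linarith)]
      simp
    rw [← h2] at h1
    exact ((ENNReal.add_left_inj ENNReal.ofReal_ne_top).1 h1).le
  · rw [toOuterMeasure_eq_zero_of_support]
    · exact zero_le
    · intro g _ hg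
      have h2 : ((g : ℕ) : ℝ) ≤ P.hmax := by exact_mod_cast Nat.lt_succ_iff.1 g.2
      simp only [Set.mem_ofPred_eq] at hg
      linarith

/-- Under `q`, the heights of the nodes of `V` are independent draws from `heightLaw` (only the
upper bounds on the probabilities of boxes are recorded). -/
def FreshOn (q : PMF (Fin P.n → P.Height)) (V : Finset (Fin P.n)) : Prop :=
  ∀ B ⊆ V, ∀ S : Set P.Height,
    q.toOuterMeasure {g | ∀ i ∈ B, g i ∈ S} ≤ P.heightLaw.toOuterMeasure S ^ B.card

lemma freshOn_independentPMF (p : Fin P.n → PMF P.Height) (A : Finset (Fin P.n))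
    (hp : ∀ i ∈ A, p i = P.heightLaw) : FreshOn (independentPMF p) A := by
  classical
  intro B hB S
  have h := toOuterMeasure_independentPMF_pi p fun i => if i ∈ B then S else Set.univ
  have hset : {f : Fin P.n → P.Height | ∀ i, f i ∈ if i ∈ B then S else Set.univ}
      = {g | ∀ i ∈ B, g i ∈ S} := by
    ext f
    simp only [Set.mem_ofPred_eq]
    refine forall_congr' fun i => ?_
    split_ifs with hi <;> simp [hi]
  rw [hset] at h
  rw [h, ← Finset.prod_subset (Finset.subset_univ B)]
  · rw [← Finset.prod_const]
    exact (Finset.prod_congr rfl fun i hi => by rw [if_pos hi, hp i (hB hi)]).le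
  · intro i _ hi
    rw [if_neg hi]
    simpa using toOuterMeasure_add_compl (p i) Set.univ

end HeightLaw

/-! ### Thresholds and sizes -/

/-- The height threshold `m * con * 𝔥`. Heights exceed it with probability about
`log^{-m * con} n`; the sets `S_{ℓ,τ}` lie between the thresholds `8 * ℓ + 2 * τ + 1` and
`8 * ℓ + 2 * τ + 3`. -/
def Params.thr (P : Params) (m : ℕ) : ℝ := m * P.con * P.hUnit

/-- The number of nodes among which one with a height above `P.thr m` is to be expected, with a
safety factor `log^x n`. -/
def Params.size (P : Params) (x : ℝ) (m : ℕ) : ℕ := ⌈P.L ^ (m * P.con + x)⌉₊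

/-- `n` and `con` are so large, depending on `φ` and on the exponent `x` of the polylogarithmic
safety margins, that all estimates hold. The bound on `con` lets the gap `log^{2 con} n` between
consecutive thresholds in use absorb two safety margins `log^x n`, the bound on `L * φ` absorbs
the constants in the probabilities of failure and the loss `1 / φ` from rounding thresholds. -/
structure Params.Large (P : Params) (x : ℝ) : Prop where
  four_le : 4 ≤ x
  con_ge : x + 2 ≤ P.con
  L_ge : 4 ≤ P.L
  L_φ : 18 ≤ P.L * P.φ


section Estimates

variable {P : Params} {x : ℝ}

lemma Params.Large.L_pos (hP : P.Large x) : 0 < P.L := by linarith [hP.L_ge]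

lemma Params.Large.one_lt_L (hP : P.Large x) : 1 < P.L := by linarith [hP.L_ge]

lemma Params.Large.con_pos (hP : P.Large x) : 0 < P.con := by linarith [hP.con_ge, hP.four_le]

lemma Params.Large.n_pos (hP : P.Large x) : 0 < P.n := by
  rcases Nat.eq_zero_or_pos P.n with h | h
  · have := hP.L_pos
    simp [Params.L, h] at this
  · exact h

lemma Params.one_lt_inv_φ (P : Params) : 1 < 1 / P.φ := by
  rw [lt_div_iff₀ P.φ_pos]; linarith [P.φ_lt_one]

lemma Params.Large.hUnit_pos (hP : P.Large x) : 0 < P.hUnit :=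
  Real.logb_pos P.one_lt_inv_φ hP.one_lt_L

lemma Params.Large.con_mul_hUnit_pos (hP : P.Large x) : 0 < P.con * P.hUnit :=
  mul_pos hP.con_pos hP.hUnit_pos

lemma Params.Large.thr_nonneg (hP : P.Large x) (m : ℕ) : 0 ≤ P.thr m := by
  rw [Params.thr, mul_assoc]
  exact mul_nonneg m.cast_nonneg hP.con_mul_hUnit_pos.le

lemma Params.Large.thr_le_thr (hP : P.Large x) {m m' : ℕ} (h : m ≤ m') : P.thr m ≤ P.thr m' := by
  rw [Params.thr, Params.thr, mul_assoc, mul_assoc]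
  exact mul_le_mul_of_nonneg_right (by exact_mod_cast h) hP.con_mul_hUnit_pos.le

lemma Params.inSub_iff {ℓ τ h : ℕ} :
    P.InSub ℓ τ h ↔ P.thr (8 * ℓ + 2 * τ + 1) < (h : ℝ) ∧ (h : ℝ) ≤ P.thr (8 * ℓ + 2 * τ + 3) := by
  simp only [Params.InSub, Params.thr]
  push_cast
  simp only [add_assoc]

lemma Params.Large.eq_of_inSub (hP : P.Large x) {ℓ ℓ' τ τ' h : ℕ} (hτ : τ < 4) (hτ' : τ' < 4)
    (h₁ : P.InSub ℓ τ h) (h₂ : P.InSub ℓ' τ' h) : ℓ = ℓ' := by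
  rw [Params.inSub_iff] at h₁ h₂
  have key : ∀ {a b : ℕ}, P.thr a < P.thr b → a < b := fun {a b} hab => by
    by_contra hcon
    exact absurd (hP.thr_le_thr (not_lt.1 hcon)) (not_le.2 hab)
  have h3 := key (h₁.1.trans_le h₂.2)
  have h4 := key (h₂.1.trans_le h₁.2)
  omega

lemma Params.Large.logb_L_ge_one (hP : P.Large x) : 1 ≤ Real.logb 2 P.L := by
  rw [Real.le_logb_iff_rpow_le (by norm_num) hP.L_pos]
  norm_num
  linarith [hP.L_ge]

lemma Params.Large.eight_K_mul_le (hP : P.Large x) :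
    8 * (P.K : ℝ) * P.con * Real.logb 2 P.L ≤ P.L := by
  have hpos : 0 < 8 * P.con * Real.logb 2 P.L :=
    mul_pos (mul_pos (by norm_num) hP.con_pos) (by linarith [hP.logb_L_ge_one])
  have h := Nat.floor_le (div_nonneg hP.L_pos.le hpos.le)
  rw [le_div_iff₀ hpos] at h
  calc _ = (P.K : ℝ) * (8 * P.con * Real.logb 2 P.L) := by ring
    _ ≤ _ := h

lemma Params.Large.eight_K_le (hP : P.Large x) : 8 * (P.K : ℝ) ≤ P.L := by
  refine le_trans ?_ hP.eight_K_mul_le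
  have h1 := hP.logb_L_ge_one
  have h2 : 1 ≤ P.con := by linarith [hP.con_ge, hP.four_le]
  have h3 : 1 ≤ P.con * Real.logb 2 P.L := one_le_mul_of_one_le_of_one_le h2 h1
  rw [mul_assoc]
  exact le_mul_of_one_le_right (by positivity) h3

lemma Params.Large.eight_K_mul_log_le (hP : P.Large x) :
    8 * (P.K : ℝ) * P.con * Real.log P.L ≤ Real.log P.n := by
  have h := hP.eight_K_mul_le
  have h2 : (0 : ℝ) < Real.log 2 := Real.log_pos (by norm_num)
  nth_rewrite 2 [Params.L] at h
  rw [Real.logb, Real.logb, ← mul_div_assoc, div_le_div_iff_of_pos_right h2] at h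
  exact h

lemma Params.Large.rpow_le_n (hP : P.Large x) {a : ℝ} (ha : a ≤ 8 * P.K * P.con) :
    P.L ^ a ≤ P.n := by
  have hn : (0 : ℝ) < P.n := by exact_mod_cast hP.n_pos
  rw [← Real.log_le_log_iff (Real.rpow_pos_of_pos hP.L_pos _) hn, Real.log_rpow hP.L_pos]
  refine le_trans ?_ hP.eight_K_mul_log_le
  exact mul_le_mul_of_nonneg_right ha (Real.log_pos hP.one_lt_L).le

lemma Params.Large.thr_lt_hmax (hP : P.Large x) {m : ℕ} (hm : m < 8 * P.K) :
    P.thr m < P.hmax := by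
  have hlt : P.thr m < 8 * P.K * P.con * P.hUnit := by
    rw [Params.thr, mul_assoc, mul_assoc]
    exact mul_lt_mul_of_pos_right (by exact_mod_cast hm) hP.con_mul_hUnit_pos
  refine hlt.trans_le (le_trans ?_ (Nat.le_ceil _))
  have hφ : 0 < Real.log (1 / P.φ) := Real.log_pos P.one_lt_inv_φ
  rw [Params.hUnit, Real.logb, Real.logb, ← mul_div_assoc, div_le_div_iff_of_pos_right hφ]
  exact hP.eight_K_mul_log_le

lemma Params.Large.φ_rpow_thr (hP : P.Large x) (m : ℕ) :
    P.φ ^ P.thr m = P.L ^ (-(m * P.con)) := by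
  have h : P.φ ^ P.hUnit = P.L⁻¹ := by
    have h1 : (1 / P.φ) ^ P.hUnit = P.L :=
      Real.rpow_logb (by have := P.φ_pos; positivity) P.one_lt_inv_φ.ne' hP.L_pos
    rw [one_div, Real.inv_rpow P.φ_pos.le] at h1
    rw [← h1, inv_inv]
  rw [Params.thr, mul_comm, Real.rpow_mul P.φ_pos.le, h, Real.inv_rpow hP.L_pos.le,
    Real.rpow_neg hP.L_pos.le]

lemma Params.Large.le_φ_pow_floor (hP : P.Large x) (m : ℕ) :
    P.L ^ (-(m * P.con)) ≤ P.φ ^ ⌊P.thr m⌋₊ := by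
  rw [← hP.φ_rpow_thr, ← Real.rpow_natCast]
  exact Real.rpow_le_rpow_of_exponent_ge P.φ_pos P.φ_lt_one.le (Nat.floor_le (hP.thr_nonneg m))

lemma Params.Large.φ_pow_floor_le (hP : P.Large x) (m : ℕ) :
    P.φ ^ ⌊P.thr m⌋₊ ≤ P.L ^ (-(m * P.con)) / P.φ := by
  rw [le_div_iff₀ P.φ_pos, ← hP.φ_rpow_thr, ← pow_succ, ← Real.rpow_natCast]
  refine Real.rpow_le_rpow_of_exponent_ge P.φ_pos P.φ_lt_one.le ?_
  push_cast
  exact (Nat.lt_floor_add_one _).le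

lemma Params.Large.rpow_le_rpow (hP : P.Large x) {a b : ℝ} (h : a ≤ b) : P.L ^ a ≤ P.L ^ b :=
  Real.rpow_le_rpow_of_exponent_le hP.one_lt_L.le h

lemma Params.Large.size_le (hP : P.Large x) (m : ℕ) :
    (P.size x m : ℝ) ≤ P.L ^ (m * P.con + x + 1) := by
  have h1 : (1 : ℝ) ≤ P.L ^ (m * P.con + x) :=
    Real.one_le_rpow hP.one_lt_L.le
      (by have := hP.con_pos; have := hP.four_le; positivity)
  have h2 := (Nat.ceil_lt_add_one (zero_le_one.trans h1)).le
  rw [Real.rpow_add_one hP.L_pos.ne']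
  have h4 := hP.L_ge
  rw [Params.size]
  nlinarith

/-- Two thresholds further up, even sets that are too small by a factor `log^x n` are larger than
`P.size x m`. -/
lemma Params.Large.size_le_rpow (hP : P.Large x) (m : ℕ) :
    (P.size x m : ℝ) ≤ P.L ^ ((m + 2 : ℕ) * P.con - x) := by
  refine (hP.size_le m).trans (hP.rpow_le_rpow ?_)
  push_cast
  linarith [hP.con_ge, hP.four_le]

lemma Params.Large.mul_size_lt (hP : P.Large x) {v : ℝ} (hv : v ≤ P.L + 1) (m : ℕ) :
    v * P.size x m < P.L ^ ((m + 3 : ℕ) * P.con - x) := by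
  have h4 := hP.L_ge
  have hs : (0 : ℝ) ≤ P.size x m := Nat.cast_nonneg _
  have hpos : 0 < P.L ^ (m * P.con + x + 1) := Real.rpow_pos_of_pos hP.L_pos _
  calc v * P.size x m ≤ (P.L + 1) * P.L ^ (m * P.con + x + 1) :=
        mul_le_mul hv (hP.size_le m) hs (by linarith)
    _ < P.L ^ (2 : ℝ) * P.L ^ (m * P.con + x + 1) := by
        refine mul_lt_mul_of_pos_right ?_ hpos
        rw [Real.rpow_two]; nlinarith
    _ = P.L ^ (2 + (m * P.con + x + 1)) := (Real.rpow_add hP.L_pos _ _).symm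
    _ ≤ _ := hP.rpow_le_rpow (by push_cast; linarith [hP.con_ge, hP.four_le])

lemma Params.Large.size_le_n (hP : P.Large x) {m : ℕ} (hm : m + 3 ≤ 8 * P.K) :
    P.size x m ≤ P.n := by
  have h : (P.size x m : ℝ) ≤ P.n := by
    refine (hP.size_le m).trans (hP.rpow_le_n ?_)
    have hm' : (m : ℝ) + 3 ≤ 8 * P.K := by exact_mod_cast hm
    have := mul_le_mul_of_nonneg_right hm' hP.con_pos.le
    linarith [hP.con_ge, hP.four_le]
  exact_mod_cast h

lemma Params.Large.lt_levelOfHeight (hP : P.Large x) {h ℓ : ℕ} (hh : P.thr (8 * (ℓ + 1)) < h) :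
    ℓ + 1 ≤ P.levelOfHeight h := by
  have hpos : 0 < 8 * P.con * P.hUnit := by
    have := hP.con_mul_hUnit_pos; nlinarith
  have h1 : ((ℓ + 1 : ℕ) : ℝ) < (h : ℝ) / (8 * P.con * P.hUnit) := by
    rw [lt_div_iff₀ hpos]
    refine lt_of_eq_of_lt ?_ hh
    rw [Params.thr]; push_cast; ring
  have h2 := Nat.lt_ceil.2 h1
  rw [Params.levelOfHeight]
  omega

end Estimates

/-! ### Ranks and the sweep -/

section Ranks

variable {D : Type u} [LinearOrder D] {n : ℕ} {item : Fin n → D}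

lemma rank_le_rank_of_le {i j : Fin n} (h : item i ≤ item j) : rank item i ≤ rank item j := by
  classical
  refine Finset.card_le_card fun k hk => ?_
  simp only [Finset.mem_filter, Finset.mem_univ, true_and] at hk ⊢
  exact hk.trans h

lemma rank_lt_rank_of_lt {i j : Fin n} (h : item i < item j) : rank item i < rank item j := by
  classical
  refine Finset.card_lt_card ⟨fun k hk => ?_, fun hsub => ?_⟩
  · simp only [Finset.mem_filter, Finset.mem_univ, true_and] at hk ⊢
    exact hk.trans h.le
  · have := hsub (show j ∈ _ by simp)
    simp only [Finset.mem_filter, Finset.mem_univ, true_and] at this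
    exact absurd h (not_lt.2 this)

lemma lt_of_rank_lt_rank {i j : Fin n} (h : rank item i < rank item j) : item i < item j := by
  by_contra hcon
  exact absurd (rank_le_rank_of_le (not_lt.1 hcon)) (not_le.2 h)

lemma rank_injective (hi : Function.Injective item) : Function.Injective (rank item) := by
  intro i j h
  rcases lt_trichotomy (item i) (item j) with h' | h' | h'
  · exact absurd h (rank_lt_rank_of_lt h').ne
  · exact hi h'
  · exact absurd h (rank_lt_rank_of_lt h').ne'

lemma one_le_rank (item : Fin n → D) (i : Fin n) : 1 ≤ rank item i := by
  classical
  exact Finset.card_pos.2 ⟨i, by simp⟩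

lemma rank_le (item : Fin n → D) (i : Fin n) : rank item i ≤ n := by
  classical
  exact (Finset.card_le_univ _).trans (by simp)

open Classical in
lemma card_rank_le (hi : Function.Injective item) {N : ℕ} (hN : N ≤ n) :
    (Finset.univ.filter fun i => rank item i ≤ N).card = N := by
  have himage : Finset.univ.image (rank item) = Finset.Icc 1 n := by
    refine Finset.eq_of_subset_of_card_le ?_ ?_
    · intro k hk
      obtain ⟨i, -, rfl⟩ := Finset.mem_image.1 hk
      exact Finset.mem_Icc.2 ⟨one_le_rank _ _, rank_le _ _⟩
    · rw [Finset.card_image_of_injective _ (rank_injective hi)]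
      simp
  rw [← Finset.card_image_of_injective _ (rank_injective hi)]
  have : (Finset.univ.filter fun i => rank item i ≤ N).image (rank item) = Finset.Icc 1 N := by
    ext k
    simp only [Finset.mem_image, Finset.mem_filter, Finset.mem_univ, true_and, Finset.mem_Icc]
    constructor
    · rintro ⟨i, h, rfl⟩
      exact ⟨one_le_rank _ _, h⟩
    · rintro ⟨h1, h2⟩
      have hk : k ∈ Finset.univ.image (rank item) := by
        rw [himage, Finset.mem_Icc]; exact ⟨h1, h2.trans hN⟩
      obtain ⟨i, -, rfl⟩ := Finset.mem_image.1 hk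
      exact ⟨i, h2, rfl⟩
  rw [this]
  simp

open Classical in
lemma card_rank_le_real (hi : Function.Injective item) {R : ℝ} (hR : 0 ≤ R) :
    ((Finset.univ.filter fun i => (rank item i : ℝ) ≤ R).card : ℝ) ≤ R := by
  rw [← Finset.card_image_of_injective _ (rank_injective hi)]
  refine le_trans ?_ (Nat.floor_le hR)
  have : ((Finset.univ.filter fun i => (rank item i : ℝ) ≤ R).image (rank item)).card
      ≤ (Finset.Icc 1 ⌊R⌋₊).card := by
    refine Finset.card_le_card fun k hk => ?_
    simp only [Finset.mem_image, Finset.mem_filter, Finset.mem_univ, true_and] at hk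
    obtain ⟨i, h, rfl⟩ := hk
    exact Finset.mem_Icc.2 ⟨one_le_rank _ _, Nat.le_floor h⟩
  rw [Nat.card_Icc, Nat.add_sub_cancel] at this
  exact_mod_cast this

/-- `A` is an initial segment of the nodes in the order of their items. -/
def IsInitial (item : Fin n → D) (A : Finset (Fin n)) : Prop :=
  ∀ i ∈ A, ∀ j, item j ≤ item i → j ∈ A

lemma IsInitial.rank_le_card {A : Finset (Fin n)} (hA : IsInitial item A) {i : Fin n}
    (hi : i ∈ A) : rank item i ≤ A.card := by
  classical
  refine Finset.card_le_card fun j hj => ?_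
  simp only [Finset.mem_filter, Finset.mem_univ, true_and] at hj
  exact hA i hi j hj

lemma IsInitial.mem_of_rank_le {A : Finset (Fin n)} (hA : IsInitial item A) {i : Fin n}
    (h : rank item i ≤ A.card) : i ∈ A := by
  classical
  by_contra hi
  have : (insert i A).card ≤ rank item i := by
    refine Finset.card_le_card fun j hj => ?_
    simp only [Finset.mem_filter, Finset.mem_univ, true_and]
    rcases Finset.mem_insert.1 hj with rfl | hj
    · exact le_rfl
    · by_contra hcon
      exact hi (hA j hj i (not_le.1 hcon).le)
  rw [Finset.card_insert_of_notMem hi] at this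
  omega

lemma rank_le_add_card {f g : Fin n → D} {V : Finset (Fin n)} (h : ∀ i, i ∉ V → g i = f i)
    {j : Fin n} (hj : j ∉ V) : rank g j ≤ rank f j + V.card := by
  classical
  refine le_trans (Finset.card_le_card fun k hk => ?_) (Finset.card_union_le _ _)
  simp only [Finset.mem_filter, Finset.mem_univ, true_and, Finset.mem_union] at hk ⊢
  by_cases hkV : k ∈ V
  · exact Or.inr hkV
  · rw [h k hkV, h j hj] at hk
    exact Or.inl hk

/-- The sweep stores exactly the nodes whose item is minimal among the nodes of `A` that have at
least their height. -/
lemma mem_sweep (hinj : Function.Injective item) (height : Fin n → ℕ) (A : Finset (Fin n))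
    (h : ℕ) (dmin : WithTop D) (i : Fin n) :
    i ∈ sweep item height A h dmin ↔ i ∈ A ∧ 1 ≤ height i ∧ height i ≤ h ∧
      (item i : WithTop D) < dmin ∧
      ∀ j ∈ A, height i ≤ height j → height j ≤ h → item i ≤ item j := by
  classical
  induction h generalizing dmin with
  | zero =>
    simp only [sweep, Finset.notMem_empty, false_iff]
    rintro ⟨-, h1, h2, -⟩
    omega
  | succ h ih =>
    simp only [sweep, Finset.mem_union, ih, Finset.mem_filter, lt_min_iff,
      Finset.lt_inf_iff (WithTop.coe_lt_top (item i)), WithTop.coe_lt_coe]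
    constructor
    · rintro (⟨⟨hA, hh, hd⟩, hmin⟩ | ⟨hA, h1, hh, ⟨hd, hlow⟩, hmin⟩)
      · refine ⟨hA, by omega, by omega, hd, fun j hj h1 h2 => ?_⟩
        by_cases hjd : (item j : WithTop D) < dmin
        · exact hmin j ⟨hj, by omega, hjd⟩
        · exact (WithTop.coe_lt_coe.1 (hd.trans_le (not_lt.1 hjd))).le
      · refine ⟨hA, h1, by omega, hd, fun j hj h2 h3 => ?_⟩
        by_cases hjh : height j ≤ h
        · exact hmin j hj h2 hjh
        · by_cases hjd : (item j : WithTop D) < dmin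
          · exact (hlow j ⟨hj, by omega, hjd⟩).le
          · exact (WithTop.coe_lt_coe.1 (hd.trans_le (not_lt.1 hjd))).le
    · rintro ⟨hA, h1, hh, hd, hmin⟩
      by_cases hih : height i = h + 1
      · exact Or.inl ⟨⟨hA, hih, hd⟩, fun j hj => hmin j hj.1 (by omega) (by omega)⟩
      · refine Or.inr ⟨hA, h1, by omega, ⟨hd, fun j hj => ?_⟩,
          fun j hj h2 h3 => hmin j hj h2 (by omega)⟩
        refine lt_of_le_of_ne (hmin j hj.1 (by omega) (by omega)) fun heq => ?_
        rw [hinj heq] at hih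
        exact hih hj.2.1

end Ranks

/-! ### Sparse and tall heights -/

section Heights

variable {P : Params} {D : Type u} [LinearOrder D] {x : ℝ}

/-- In each of the item assignments of `F`, no node of `V` is much higher than its rank suggests:
heights above `P.thr m` occur on `V` only at ranks above `log^{m * con - x} n`. -/
def SparseOn (x : ℝ) (F : Finset (Fin P.n → D)) (V : Finset (Fin P.n))
    (g : Fin P.n → P.Height) : Prop :=
  ∀ f ∈ F, ∀ m < 8 * P.K, ∀ i ∈ V, (rank f i : ℝ) ≤ P.L ^ (m * P.con - x) →
    ((g i : ℕ) : ℝ) ≤ P.thr m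

/-- Every set `C m` with at least `P.size x m` nodes has a node higher than `P.thr m`. -/
def Tall (x : ℝ) (C : ℕ → Finset (Fin P.n)) (g : Fin P.n → P.Height) : Prop :=
  ∀ m < 8 * P.K, P.size x m ≤ (C m).card → ∃ i ∈ C m, P.thr m < ((g i : ℕ) : ℝ)

/-- A bound on the probability that fresh heights are not sparse or not tall. -/
def Params.err (P : Params) (x : ℝ) : ℝ := 3 * P.L ^ (2 - x) / P.φ

lemma Params.Large.err_nonneg (hP : P.Large x) : 0 ≤ P.err x :=
  div_nonneg (mul_nonneg (by norm_num) (Real.rpow_nonneg hP.L_pos.le _)) P.φ_pos.le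

lemma Params.Large.inv_φ_le (hP : P.Large x) : 1 / P.φ ≤ P.L / 18 := by
  rw [div_le_div_iff₀ P.φ_pos (by norm_num)]
  linarith [hP.L_φ]

lemma Params.Large.err_le_half (hP : P.Large x) : ENNReal.ofReal (P.err x) ≤ 2⁻¹ := by
  have h1 : P.L ^ (2 - x) ≤ P.L ^ (-2 : ℝ) := hP.rpow_le_rpow (by linarith [hP.four_le])
  have h2 : P.L ^ (-2 : ℝ) * P.L = P.L⁻¹ := by
    rw [← Real.rpow_add_one hP.L_pos.ne', ← Real.rpow_neg_one]; norm_num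
  have h3 : P.L⁻¹ ≤ 1 := inv_le_one_of_one_le₀ hP.one_lt_L.le
  have h4 : P.err x ≤ 2⁻¹ := by
    calc P.err x = 3 * P.L ^ (2 - x) * (1 / P.φ) := by rw [Params.err]; ring
      _ ≤ 3 * P.L ^ (-2 : ℝ) * (P.L / 18) := by
        have := P.φ_pos
        exact mul_le_mul (by linarith) hP.inv_φ_le (by positivity)
          (mul_nonneg (by norm_num) (Real.rpow_nonneg hP.L_pos.le _))
      _ = P.L ^ (-2 : ℝ) * P.L / 6 := by ring
      _ ≤ 2⁻¹ := by rw [h2]; linarith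
  calc ENNReal.ofReal (P.err x) ≤ ENNReal.ofReal 2⁻¹ := ENNReal.ofReal_le_ofReal h4
    _ = 2⁻¹ := by rw [ENNReal.ofReal_inv_of_pos (by norm_num)]; norm_num

lemma not_tall_le (hP : P.Large x) {q : PMF (Fin P.n → P.Height)} {V C : Finset (Fin P.n)}
    (hq : FreshOn q V) (hC : C ⊆ V) {m : ℕ} (hm : m < 8 * P.K) (hs : P.size x m ≤ C.card) :
    q.toOuterMeasure {g | ∀ i ∈ C, ¬ P.thr m < ((g i : ℕ) : ℝ)}
      ≤ ENNReal.ofReal (P.L ^ (-x)) := by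
  refine (hq C hC {h | ¬ P.thr m < ((h : ℕ) : ℝ)}).trans ?_
  rw [heightLaw_le_threshold (hP.thr_nonneg m) (hP.thr_lt_hmax hm)]
  have hp1 : P.φ ^ ⌊P.thr m⌋₊ ≤ 1 := pow_le_one₀ P.φ_pos.le P.φ_lt_one.le
  rw [← ENNReal.ofReal_pow (by linarith)]
  refine ENNReal.ofReal_le_ofReal ?_
  set p := P.φ ^ ⌊P.thr m⌋₊ with hp
  have hLx : 0 < P.L ^ x := Real.rpow_pos_of_pos hP.L_pos _
  have hmul : P.L ^ x ≤ C.card * p := by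
    have h1 : P.L ^ (m * P.con + x) ≤ C.card := (Nat.le_ceil _).trans (by exact_mod_cast hs)
    calc P.L ^ x = P.L ^ (m * P.con + x) * P.L ^ (-(m * P.con)) := by
          rw [← Real.rpow_add hP.L_pos]; ring_nf
      _ ≤ C.card * p := mul_le_mul h1 (hP.le_φ_pow_floor m)
          (Real.rpow_nonneg hP.L_pos.le _) (Nat.cast_nonneg _)
  calc (1 - p) ^ C.card ≤ Real.exp (-p) ^ C.card := by
        refine pow_le_pow_left₀ (by linarith) ?_ _
        linarith [Real.add_one_le_exp (-p)]
    _ = Real.exp (-(C.card * p)) := by rw [← Real.exp_nat_mul]; ring_nf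
    _ ≤ Real.exp (-(P.L ^ x)) := Real.exp_le_exp.2 (by linarith)
    _ ≤ (P.L ^ x)⁻¹ := by
        rw [Real.exp_neg]
        exact inv_anti₀ hLx (by linarith [Real.add_one_le_exp (P.L ^ x)])
    _ = P.L ^ (-x) := (Real.rpow_neg hP.L_pos.le _).symm

open Classical in
lemma not_sparse_le (hP : P.Large x) {q : PMF (Fin P.n → P.Height)} {V : Finset (Fin P.n)}
    (hq : FreshOn q V) {f : Fin P.n → D} (hf : Function.Injective f) (m : ℕ) :
    q.toOuterMeasure (⋃ i ∈ V.filter fun i => (rank f i : ℝ) ≤ P.L ^ (m * P.con - x),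
        {g | P.thr m < ((g i : ℕ) : ℝ)})
      ≤ ENNReal.ofReal (P.L ^ (-x) / P.φ) := by
  set B := V.filter fun i => (rank f i : ℝ) ≤ P.L ^ (m * P.con - x) with hB
  have hnonneg : 0 ≤ P.L ^ (m * P.con - x) := Real.rpow_nonneg hP.L_pos.le _
  have hcard : (B.card : ℝ) ≤ P.L ^ (m * P.con - x) := by
    refine le_trans ?_ (card_rank_le_real hf hnonneg)
    exact_mod_cast Finset.card_le_card (Finset.filter_subset_filter _ (Finset.subset_univ V))
  calc _ ≤ ∑ i ∈ B, q.toOuterMeasure {g | P.thr m < ((g i : ℕ) : ℝ)} :=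
        MeasureTheory.measure_biUnion_finset_le _ _
    _ ≤ ∑ i ∈ B, ENNReal.ofReal (P.φ ^ ⌊P.thr m⌋₊) := by
        refine Finset.sum_le_sum fun i hi => ?_
        have h := hq {i} (Finset.singleton_subset_iff.2 (Finset.mem_filter.1 hi).1)
          {h | P.thr m < ((h : ℕ) : ℝ)}
        simp only [Finset.mem_singleton, forall_eq, Finset.card_singleton, pow_one] at h
        exact h.trans (heightLaw_gt_threshold_le (hP.thr_nonneg m))
    _ = ENNReal.ofReal (B.card * P.φ ^ ⌊P.thr m⌋₊) := by
        rw [Finset.sum_const, nsmul_eq_mul, ENNReal.ofReal_mul (Nat.cast_nonneg _),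
          ENNReal.ofReal_natCast]
    _ ≤ ENNReal.ofReal (P.L ^ (-x) / P.φ) := by
        refine ENNReal.ofReal_le_ofReal ?_
        calc _ ≤ P.L ^ (m * P.con - x) * (P.L ^ (-(m * P.con)) / P.φ) :=
              mul_le_mul hcard (hP.φ_pow_floor_le m) (pow_nonneg P.φ_pos.le _) hnonneg
          _ = P.L ^ (-x) / P.φ := by
              rw [← mul_div_assoc, ← Real.rpow_add hP.L_pos]; ring_nf

/-- Fresh heights are sparse and tall, up to a small probability of failure. -/
lemma fresh_fail_le (hP : P.Large x) {q : PMF (Fin P.n → P.Height)} {V : Finset (Fin P.n)}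
    (hq : FreshOn q V) {F : Finset (Fin P.n → D)} (hF : ∀ f ∈ F, Function.Injective f)
    (hcard : (F.card : ℝ) ≤ P.L + 1) {C : ℕ → Finset (Fin P.n)} (hC : ∀ m, C m ⊆ V) :
    q.toOuterMeasure {g | SparseOn x F V g ∧ Tall x C g}ᶜ ≤ ENNReal.ofReal (P.err x) := by
  classical
  have hLx : 0 < P.L ^ (-x) := Real.rpow_pos_of_pos hP.L_pos _
  have hφ := P.φ_pos
  set S₁ : Set (Fin P.n → P.Height) := ⋃ f ∈ F, ⋃ m ∈ Finset.range (8 * P.K),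
    ⋃ i ∈ V.filter fun i => (rank f i : ℝ) ≤ P.L ^ (m * P.con - x),
      {g | P.thr m < ((g i : ℕ) : ℝ)} with hS₁
  set M := (Finset.range (8 * P.K)).filter fun m => P.size x m ≤ (C m).card with hM
  set S₂ : Set (Fin P.n → P.Height) := ⋃ m ∈ M,
    {g | ∀ i ∈ C m, ¬ P.thr m < ((g i : ℕ) : ℝ)} with hS₂
  have hsub : {g | SparseOn x F V g ∧ Tall x C g}ᶜ ⊆ S₁ ∪ S₂ := by
    intro g hg
    by_contra hcon
    simp only [hS₁, hS₂, hM, Set.mem_union, Set.mem_iUnion, Finset.mem_range, Finset.mem_filter,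
      Set.mem_ofPred_eq, not_or, not_exists] at hcon
    refine hg ⟨fun f hf m hm i hi hr => ?_, fun m hm hs => ?_⟩
    · exact not_lt.1 (hcon.1 f hf m hm i ⟨hi, hr⟩)
    · by_contra h
      push Not at h
      exact hcon.2 m ⟨hm, hs⟩ fun i hi => not_lt.2 (h i hi)
  have h₁ : q.toOuterMeasure S₁ ≤ ENNReal.ofReal (F.card * ((8 * P.K : ℕ) *
      (P.L ^ (-x) / P.φ))) := by
    calc q.toOuterMeasure S₁
        ≤ ∑ f ∈ F, ∑ m ∈ Finset.range (8 * P.K), ENNReal.ofReal (P.L ^ (-x) / P.φ) :=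
          (MeasureTheory.measure_biUnion_finset_le _ _).trans <| Finset.sum_le_sum fun f hf =>
            (MeasureTheory.measure_biUnion_finset_le _ _).trans <| Finset.sum_le_sum fun m _ =>
              not_sparse_le hP hq (hF f hf) m
      _ = _ := by
          rw [Finset.sum_const, Finset.sum_const, nsmul_eq_mul, nsmul_eq_mul, Finset.card_range,
            ENNReal.ofReal_mul (Nat.cast_nonneg _), ENNReal.ofReal_mul (Nat.cast_nonneg _),
            ENNReal.ofReal_natCast, ENNReal.ofReal_natCast]
  have h₂ : q.toOuterMeasure S₂ ≤ ENNReal.ofReal ((8 * P.K : ℕ) * P.L ^ (-x)) := by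
    calc q.toOuterMeasure S₂ ≤ ∑ m ∈ M, ENNReal.ofReal (P.L ^ (-x)) :=
          (MeasureTheory.measure_biUnion_finset_le _ _).trans <| Finset.sum_le_sum fun m hm => by
            rw [hM, Finset.mem_filter, Finset.mem_range] at hm
            exact not_tall_le hP hq (hC m) hm.1 hm.2
      _ ≤ ∑ m ∈ Finset.range (8 * P.K), ENNReal.ofReal (P.L ^ (-x)) :=
          Finset.sum_le_sum_of_subset (Finset.filter_subset _ _)
      _ = _ := by
          rw [Finset.sum_const, nsmul_eq_mul, Finset.card_range,
            ENNReal.ofReal_mul (Nat.cast_nonneg _), ENNReal.ofReal_natCast]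
  have hK : ((8 * P.K : ℕ) : ℝ) ≤ P.L := by push_cast; exact hP.eight_K_le
  calc _ ≤ q.toOuterMeasure S₁ + q.toOuterMeasure S₂ :=
        (MeasureTheory.measure_mono hsub).trans (MeasureTheory.measure_union_le _ _)
    _ ≤ _ := add_le_add h₁ h₂
    _ = ENNReal.ofReal (F.card * ((8 * P.K : ℕ) * (P.L ^ (-x) / P.φ)) +
          (8 * P.K : ℕ) * P.L ^ (-x)) := (ENNReal.ofReal_add (by positivity) (by positivity)).symm
    _ ≤ ENNReal.ofReal (P.err x) := by
        refine ENNReal.ofReal_le_ofReal ?_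
        have hd : P.L ^ (-x) ≤ P.L ^ (-x) / P.φ := by
          rw [le_div_iff₀ hφ]; nlinarith [P.φ_lt_one]
        have hd0 : 0 ≤ P.L ^ (-x) / P.φ := by positivity
        have hL := hP.L_ge
        calc _ ≤ (P.L + 1) * (P.L * (P.L ^ (-x) / P.φ)) + P.L * (P.L ^ (-x) / P.φ) := by
              refine add_le_add ?_ (mul_le_mul hK hd hLx.le (by linarith))
              exact mul_le_mul hcard (mul_le_mul_of_nonneg_right hK hd0)
                (by positivity) (by linarith)
          _ ≤ 3 * P.L ^ 2 * (P.L ^ (-x) / P.φ) := by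
              rw [← mul_assoc, ← add_mul]
              exact mul_le_mul_of_nonneg_right (by nlinarith) hd0
          _ = P.err x := by
              rw [Params.err, show (2 - x) = -x + (2 : ℕ) by push_cast; ring,
                Real.rpow_add_natCast hP.L_pos.ne']
              ring

end Heights

/-! ### Sequences of UPDATEs -/

section Updates

variable {P : Params} {D : Type u} {x : ℝ}

/-- Every representative is a stored node of `S_{ℓ,2}`. -/
def RepStored (s : State P D) : Prop :=
  ∀ ℓ r, s.rep ℓ = some r → r ∈ sub s.stored s.height ℓ 2

/-- The nodes that observe one of the given UPDATEs. -/
def updated {n : ℕ} (us : List (Fin n × D)) : Finset (Fin n) := (us.map Prod.fst).toFinset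

lemma updated_cons {n : ℕ} (v : Fin n × D) (us : List (Fin n × D)) :
    updated (v :: us) = insert v.1 (updated us) := by
  simp [updated]

/-- The facts about the state `s'` after UPDATEs of the nodes of `V` in the state `s` that hold for
all random choices. -/
structure AfterUpdates (s : State P D) (V : Finset (Fin P.n)) (s' : State P D) : Prop where
  item_eq : ∀ i, i ∉ V → s'.item i = s.item i
  height_eq : ∀ i, i ∉ V → s'.height i = s.height i
  stored : ∀ i ∈ s'.stored, i ∈ s.stored ∧ i ∉ V
  touched : ∀ i, i ∈ V ∨ i ∈ s.touched → i ∈ s'.touched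
  repStored : RepStored s → RepStored s'

lemma mem_sub {stored : Finset (Fin P.n)} {height : Fin P.n → P.Height} {ℓ τ : ℕ} {i : Fin P.n} :
    i ∈ sub stored height ℓ τ ↔ i ∈ stored ∧ P.InSub ℓ τ (height i) := by
  classical
  simp [sub]

lemma AfterUpdates.trans {s s' s'' : State P D} {V W : Finset (Fin P.n)} [DecidableEq (Fin P.n)]
    (h : AfterUpdates s V s') (h' : AfterUpdates s' W s'') : AfterUpdates s (V ∪ W) s'' where
  item_eq i hi := by
    rw [Finset.mem_union, not_or] at hi
    rw [h'.item_eq i hi.2, h.item_eq i hi.1]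
  height_eq i hi := by
    rw [Finset.mem_union, not_or] at hi
    rw [h'.height_eq i hi.2, h.height_eq i hi.1]
  stored i hi := by
    have h1 := h'.stored i hi
    have h2 := h.stored i h1.1
    exact ⟨h2.1, by simp [h1.2, h2.2]⟩
  touched i hi := by
    refine h'.touched i ?_
    rw [Finset.mem_union] at hi
    have := h.touched i
    tauto
  repStored hs := h'.repStored (h.repStored hs)

variable [LinearOrder D]

lemma afterUpdates_update (hP : P.Large x) {s s' : State P D} {i : Fin P.n} {d : D}
    (h : s' ∈ (update s i d).support) :
    s'.item = Function.update s.item i d ∧ AfterUpdates s {i} s' := by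
  classical
  rw [update, PMF.mem_support_map_iff] at h
  obtain ⟨g, -, rfl⟩ := h
  refine ⟨rfl, ?_, ?_, ?_, ?_, ?_⟩
  · intro j hj
    exact Function.update_of_ne (by simpa using hj) _ _
  · intro j hj
    exact Function.update_of_ne (by simpa using hj) _ _
  · intro j hj
    have hj := Finset.mem_erase.1 (Finset.mem_filter.1 hj).1
    exact ⟨hj.2, by simpa using hj.1⟩
  · intro j hj
    simpa using hj
  · intro hs ℓ r hr
    dsimp only at hr ⊢
    split_ifs at hr with hfire
    have hsub := mem_sub.1 (hs ℓ r hr)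
    have hri : r ≠ i := fun h => hfire (Or.inr (Or.inl (h ▸ hr)))
    rw [mem_sub, Function.update_of_ne hri]
    refine ⟨Finset.mem_filter.2 ⟨Finset.mem_erase.2 ⟨hri, hsub.1⟩, ?_⟩, hsub.2⟩
    -- the deletion of another class does not touch `r`, as different classes have disjoint heights
    intro ℓ' hfire' τ hτ hmem
    have := hP.eq_of_inSub (by norm_num) (Finset.mem_range.1 hτ) hsub.2 (mem_sub.1 hmem).2
    exact hfire ((Fin.ext this : ℓ = ℓ') ▸ hfire')

lemma afterUpdates_updates (hP : P.Large x) {us : List (Fin P.n × D)} {s s' : State P D}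
    (h : s' ∈ (updates s us).support) :
    s'.item = itemsAfter s.item us ∧ AfterUpdates s (updated us) s' := by
  induction us generalizing s with
  | nil =>
    rw [updates, PMF.support_pure, Set.mem_singleton_iff] at h
    subst h
    exact ⟨rfl, fun _ _ => rfl, fun _ _ => rfl, fun i hi => ⟨hi, by simp [updated]⟩,
      fun i hi => by simpa [updated] using hi, id⟩
  | cons v us ih =>
    rw [updates, PMF.mem_support_bind_iff] at h
    obtain ⟨s₁, hs₁, hs'⟩ := h
    have h1 := afterUpdates_update hP hs₁
    have h2 := ih hs'
    refine ⟨?_, ?_⟩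
    · rw [h2.1, h1.1]; rfl
    · rw [updated_cons, Finset.insert_eq]
      exact h1.2.trans h2.2

/-- After a sequence of UPDATEs the heights of the updated nodes are independent fresh draws. -/
lemma freshOn_updates (hP : P.Large x) (s : State P D) (us : List (Fin P.n × D)) :
    FreshOn ((updates s us).map State.height) (updated us) := by
  intro B hB S
  rw [PMF.toOuterMeasure_map_apply]
  induction us generalizing s B with
  | nil =>
    have : B = ∅ := Finset.subset_empty.1 hB
    subst this
    rw [Finset.card_empty, pow_zero]
    exact toOuterMeasure_le_one _ _
  | cons v us ih =>
    rw [updated_cons] at hB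
    rw [updates]
    by_cases hvB : v.1 ∈ B ∧ v.1 ∉ updated us
    · have hB' : B.erase v.1 ⊆ updated us := fun i hi => by
        rw [Finset.mem_erase] at hi
        exact Finset.mem_of_mem_insert_of_ne (hB hi.2) hi.1
      rw [update, PMF.bind_map, PMF.toOuterMeasure_bind_apply]
      calc _ ≤ ∑' h, S.indicator P.heightLaw h *
              P.heightLaw.toOuterMeasure S ^ (B.erase v.1).card := by
            refine ENNReal.tsum_le_tsum fun h => ?_
            by_cases hS : h ∈ S
            · rw [Set.indicator_of_mem hS]
              refine mul_le_mul_right ((MeasureTheory.measure_mono ?_).trans (ih _ _ hB')) _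
              exact fun s' hs' i hi => hs' i (Finset.mem_of_mem_erase hi)
            · -- node `v.1` keeps its height `h ∉ S` during the remaining UPDATEs
              rw [Set.indicator_of_notMem hS, zero_mul, toOuterMeasure_eq_zero_of_support, mul_zero]
              intro s' hs' hmem
              refine hS ?_
              have h1 := (afterUpdates_updates hP hs').2.height_eq v.1 hvB.2
              have h2 := hmem v.1 hvB.1
              rw [h1] at h2
              simpa using h2
        _ = P.heightLaw.toOuterMeasure S ^ B.card := by
            rw [ENNReal.tsum_mul_right, ← PMF.toOuterMeasure_apply, ← pow_succ',
              Finset.card_erase_add_one hvB.1]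
    · have hB' : B ⊆ updated us := fun i hi => by
        rcases Finset.mem_insert.1 (hB hi) with rfl | h
        · by_contra hcon; exact hvB ⟨hi, hcon⟩
        · exact h
      have := toOuterMeasure_bind_le (update s v.1 v.2) (fun s' => updates s' us) Set.univ
        (State.height ⁻¹' {g | ∀ i ∈ B, g i ∈ S}) (ε₁ := 0) (by simp) fun s' _ _ => ih s' B hB'
      rwa [zero_add] at this

/-- The item assignments at the ends of the rounds, the current one included. -/
def futures {n : ℕ} (item : Fin n → D) : List (List (Fin n × D)) → Finset (Fin n → D)
  | [] => {item}
  | v :: us => open Classical in insert item (futures (itemsAfter item v) us)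

lemma mem_futures {n : ℕ} (item : Fin n → D) (us : List (List (Fin n × D))) :
    item ∈ futures item us := by
  cases us <;> simp [futures]

lemma card_futures_le {n : ℕ} (item : Fin n → D) (us : List (List (Fin n × D))) :
    (futures item us).card ≤ us.length + 1 := by
  classical
  induction us generalizing item with
  | nil => simp [futures]
  | cons v us ih =>
    rw [futures, List.length_cons]
    exact (Finset.card_insert_le _ _).trans (Nat.add_le_add_right (ih _) 1)

lemma injective_of_mem_futures {n : ℕ} {item : Fin n → D} {us : List (List (Fin n × D))}
    (h : AlwaysDistinct item us) : ∀ f ∈ futures item us, Function.Injective f := by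
  classical
  induction us generalizing item with
  | nil =>
    intro f hf
    rw [futures, Finset.mem_singleton] at hf
    exact hf ▸ h [] List.nil_prefix
  | cons v us ih =>
    intro f hf
    rw [futures, Finset.mem_insert] at hf
    rcases hf with rfl | hf
    · exact h [] List.nil_prefix
    · refine ih (fun vs hvs => ?_) f hf
      have := h (v ++ vs) (by rw [List.flatten_cons]; exact (List.prefix_append_right_inj v).2 hvs)
      rwa [itemsAfter, List.foldl_append] at this

end Updates

/-! ### One INITIALIZE -/

section Initialize

variable {P : Params} {D : Type u} [LinearOrder D] {x : ℝ}

/-- What holds after INITIALIZE and after each REFRESH with high probability. The heights are sparse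
for the current and all future item assignments `F`; the stored nodes of each class have ranks that
are at most `v` times the size `P.size x` belonging to the upper end of the class; and every class
has a representative. -/
structure Sound (x : ℝ) (v : ℕ) (F : Finset (Fin P.n → D)) (s : State P D) : Prop where
  sparse : SparseOn x F Finset.univ s.height
  rank_le : ∀ ℓ, ℓ + 2 ≤ P.K → ∀ j ∈ s.stored, ((s.height j : ℕ) : ℝ) ≤ P.thr (8 * (ℓ + 1)) →
    rank s.item j ≤ v * P.size x (8 * (ℓ + 1))
  repStored : RepStored s
  exists_rep : ∀ ℓ, ∃ r, s.rep ℓ = some r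

/-- The hypotheses on `s` and `A` under which INITIALIZE on `A` leads to a sound state. -/
structure Ready (x : ℝ) (v : ℕ) (F : Finset (Fin P.n → D)) (s : State P D)
    (A : Finset (Fin P.n)) : Prop where
  item_mem : s.item ∈ F
  injective : ∀ f ∈ F, Function.Injective f
  card_le : (F.card : ℝ) ≤ P.L + 1
  initial : IsInitial s.item A
  sparse : ∀ f ∈ F, ∀ m < 8 * P.K, ∀ i, i ∉ A → (rank f i : ℝ) ≤ P.L ^ (m * P.con - x) →
    ((s.height i : ℕ) : ℝ) ≤ P.thr m
  one_le : 1 ≤ v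
  rank_le : ∀ ℓ, ℓ + 2 ≤ P.K → ∀ j ∈ s.stored, j ∉ A →
    ((s.height j : ℕ) : ℝ) ≤ P.thr (8 * (ℓ + 1)) → rank s.item j ≤ v * P.size x (8 * (ℓ + 1))
  fill : ∀ ℓ < P.K, ∀ τ, τ = 1 ∨ τ = 2 → P.size x (8 * ℓ + 2 * τ + 1) ≤ A.card ∨
    ∃ j ∈ s.stored, j ∉ A ∧ P.InSub ℓ τ (s.height j)
  repStored : RepStored s

open Classical in
/-- The `P.size x m` nodes of `A` with the smallest items, provided that `A` is an initial segment
with at least so many nodes. -/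
def lowest (x : ℝ) (item : Fin P.n → D) (A : Finset (Fin P.n)) (m : ℕ) : Finset (Fin P.n) :=
  A.filter fun i => rank item i ≤ P.size x m

/-- If `A` is large enough then the redrawn heights contain one above `P.thr m` at a low rank. -/
lemma exists_tall_of_size_le {item : Fin P.n → D} (hinj : Function.Injective item)
    {A : Finset (Fin P.n)} (hA : IsInitial item A) {g : Fin P.n → P.Height}
    (hg : Tall x (lowest x item A) g) {m : ℕ} (hm : m < 8 * P.K) (hs : P.size x m ≤ A.card) :
    ∃ i ∈ A, rank item i ≤ P.size x m ∧ P.thr m < ((g i : ℕ) : ℝ) := by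
  classical
  have hcard : (lowest x item A m).card = P.size x m := by
    have hn : P.size x m ≤ P.n := hs.trans ((Finset.card_le_univ A).trans (by simp))
    rw [← card_rank_le hinj hn]
    congr 1
    ext i
    simp only [lowest, Finset.mem_filter, Finset.mem_univ, true_and, and_iff_right_iff_imp]
    exact fun hi => hA.mem_of_rank_le (hi.trans hs)
  obtain ⟨i, hi, hlt⟩ := hg m hm hcard.ge
  rw [lowest, Finset.mem_filter] at hi
  exact ⟨i, hi.1, hi.2, hlt⟩

/-- The lowest of the nodes of `A` higher than `P.thr m` is stored. It has a low rank as heights are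
tall, and therefore it is not higher than `P.thr (m + 2)`, as heights are sparse. -/
lemma exists_mem_sweep (hP : P.Large x) {item : Fin P.n → D} (hinj : Function.Injective item)
    {A : Finset (Fin P.n)} (hA : IsInitial item A) {g : Fin P.n → P.Height}
    (hsparse : SparseOn x {item} A g) (htall : Tall x (lowest x item A) g) {m : ℕ}
    (hm : m + 2 < 8 * P.K) (hs : P.size x m ≤ A.card) :
    ∃ i ∈ sweep item (fun i => (g i : ℕ)) A P.hmax ⊤,
      P.thr m < ((g i : ℕ) : ℝ) ∧ ((g i : ℕ) : ℝ) ≤ P.thr (m + 2) := by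
  classical
  obtain ⟨i, hiA, hir, hig⟩ := exists_tall_of_size_le hinj hA htall (by omega) hs
  obtain ⟨k, hk, hmin⟩ := Finset.exists_min_image
    (A.filter fun i => P.thr m < ((g i : ℕ) : ℝ)) item ⟨i, Finset.mem_filter.2 ⟨hiA, hig⟩⟩
  rw [Finset.mem_filter] at hk
  refine ⟨k, ?_, hk.2, ?_⟩
  · rw [mem_sweep hinj]
    refine ⟨hk.1, ?_, Nat.lt_succ_iff.1 (g k).2, WithTop.coe_lt_top _, fun j hj hkj _ => ?_⟩
    · have : (0 : ℝ) < ((g k : ℕ) : ℝ) := (hP.thr_nonneg m).trans_lt hk.2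
      exact_mod_cast this
    · refine hmin j (Finset.mem_filter.2 ⟨hj, hk.2.trans_le ?_⟩)
      exact_mod_cast hkj
  · refine hsparse item (Finset.mem_singleton_self _) (m + 2) hm k hk.1 ?_
    have h1 : rank item k ≤ P.size x m :=
      (rank_le_rank_of_le (hmin i (Finset.mem_filter.2 ⟨hiA, hig⟩))).trans hir
    exact le_trans (by exact_mod_cast h1) (hP.size_le_rpow m)

/-- If heights are tall then the stored nodes below a given height have small ranks, because they
are smaller than a node above this height. -/
lemma rank_le_of_mem_sweep {item : Fin P.n → D} (hinj : Function.Injective item)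
    {A : Finset (Fin P.n)} (hA : IsInitial item A) {g : Fin P.n → P.Height}
    (htall : Tall x (lowest x item A) g) {m : ℕ} (hm : m < 8 * P.K) {j : Fin P.n}
    (hj : j ∈ sweep item (fun i => (g i : ℕ)) A P.hmax ⊤) (hjm : ((g j : ℕ) : ℝ) ≤ P.thr m) :
    rank item j ≤ P.size x m := by
  rw [mem_sweep hinj] at hj
  rcases le_or_gt (P.size x m) A.card with hs | hs
  · obtain ⟨i, hiA, hir, hig⟩ := exists_tall_of_size_le hinj hA htall hm hs
    have hji : (g j : ℕ) ≤ g i := by exact_mod_cast hjm.trans hig.le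
    exact (rank_le_rank_of_le
      (hj.2.2.2.2 i hiA hji (Nat.lt_succ_iff.1 (g i).2))).trans hir
  · exact (hA.rank_le_card hj.1).trans hs.le

lemma initOn_fail_le (hP : P.Large x) {v : ℕ} {F : Finset (Fin P.n → D)} {s : State P D}
    {A : Finset (Fin P.n)} (hR : Ready x v F s A) :
    (initOn s A).toOuterMeasure {o | ∃ s', o = some s' ∧ s'.item = s.item ∧ Sound x v F s'}ᶜ
      ≤ 2 * ENNReal.ofReal (P.err x) := by
  classical
  have hinj := hR.injective _ hR.item_mem
  set q : PMF (Fin P.n → P.Height) :=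
    independentPMF fun i => if i ∈ A then P.heightLaw else PMF.pure (s.height i) with hq
  have hfresh : FreshOn q A := freshOn_independentPMF _ A fun i hi => if_pos hi
  have houtside : ∀ g ∈ q.support, ∀ i, i ∉ A → g i = s.height i := by
    intro g hg i hi
    have := mem_support_independentPMF _ hg i
    rw [if_neg hi, PMF.support_pure] at this
    exact this
  set E : Set (Fin P.n → P.Height) :=
    {g | SparseOn x F A g ∧ Tall x (lowest x s.item A) g} with hE
  have hfail : q.toOuterMeasure Eᶜ ≤ ENNReal.ofReal (P.err x) :=
    fresh_fail_le hP hfresh hR.injective hR.card_le fun m => Finset.filter_subset _ _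
  have hfill : ∀ g ∈ q.support, g ∈ E → ∀ ℓ : Fin P.K, Filled (storedAfterSweep s A g) g ℓ := by
    intro g hg hgE ℓ
    have key : ∀ τ, τ = 1 ∨ τ = 2 → (sub (storedAfterSweep s A g) g ℓ τ).Nonempty := by
      intro τ hτ
      rcases hR.fill ℓ ℓ.2 τ hτ with hs | ⟨j, hj, hjA, hjs⟩
      · obtain ⟨i, hi, h1, h2⟩ := exists_mem_sweep hP hinj hR.initial
          (fun f hf => hgE.1 f ((Finset.mem_singleton.1 hf).symm ▸ hR.item_mem)) hgE.2
          (by have := ℓ.2; omega) hs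
        exact ⟨i, mem_sub.2 ⟨Finset.mem_union_right _ hi, Params.inSub_iff.2 ⟨h1, h2⟩⟩⟩
      · refine ⟨j, mem_sub.2 ⟨Finset.mem_union_left _ (Finset.mem_sdiff.2 ⟨hj, hjA⟩), ?_⟩⟩
        rwa [houtside g hg j hjA]
    exact ⟨key 1 (Or.inl rfl), key 2 (Or.inr rfl)⟩
  have hrep := repeatUntil_fail_le q
    (fun g => ∀ ℓ : Fin P.K, Filled (storedAfterSweep s A g) g ℓ) E hP.err_le_half hfail hfill
  rw [initOn, andThen, ← add_zero (2 * ENNReal.ofReal (P.err x))]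
  refine toOuterMeasure_bind_le _ _ _
    {o | ∃ s', o = some s' ∧ s'.item = s.item ∧ Sound x v F s'}ᶜ hrep ?_
  rintro o - ⟨g, hg, rfl, hgood, hgE⟩
  refine le_of_eq (toOuterMeasure_eq_zero_of_support _ fun o ho hbad => hbad ?_)
  rw [PMF.mem_support_bind_iff] at ho
  obtain ⟨alarm, -, ho⟩ := ho
  rw [PMF.mem_support_map_iff] at ho
  obtain ⟨rep, hrepsup, rfl⟩ := ho
  have hreps : ∀ ℓ : Fin P.K, ∃ r, rep ℓ = some r ∧ r ∈ sub (storedAfterSweep s A g) g ℓ 2 := by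
    intro ℓ
    have h := mem_support_independentPMF _ hrepsup ℓ
    split_ifs at h with hkeep
    · obtain ⟨a, r, -, hr, -, hrA⟩ := hkeep
      rw [PMF.support_pure, Set.mem_singleton_iff] at h
      have h1 := mem_sub.1 (hR.repStored ℓ r hr)
      refine ⟨r, h.trans hr, mem_sub.2 ⟨Finset.mem_union_left _
        (Finset.mem_sdiff.2 ⟨h1.1, hrA⟩), ?_⟩⟩
      rw [houtside g hg r hrA]
      exact h1.2
    · obtain ⟨r, h1, h2⟩ := mem_support_pick (hgood ℓ).2 h
      exact ⟨r, h2, h1⟩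
  refine ⟨_, rfl, rfl, ?_, ?_, ?_, ?_⟩
  · intro f hf m hm i _ hr
    by_cases hiA : i ∈ A
    · exact hgE.1 f hf m hm i hiA hr
    · have := hR.sparse f hf m hm i hiA hr
      rwa [← houtside g hg i hiA] at this
  · intro ℓ hℓ j hj hjm
    rcases Finset.mem_union.1 hj with hj | hj
    · rw [Finset.mem_sdiff] at hj
      refine hR.rank_le ℓ hℓ j hj.1 hj.2 ?_
      rwa [← houtside g hg j hj.2]
    · exact (rank_le_of_mem_sweep hinj hR.initial hgE.2 (by omega) hj hjm).trans
        (Nat.le_mul_of_pos_left _ hR.one_le)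
  · intro ℓ r hr
    obtain ⟨r', h1, h2⟩ := hreps ℓ
    have : r = r' := Option.some.inj (hr.symm.trans h1)
    exact this ▸ h2
  · exact fun ℓ => (hreps ℓ).imp fun r h => h.1

end Initialize

/-! ### One REFRESH -/

section Refresh

variable {P : Params} {D : Type u} {x : ℝ}

lemma exists_of_lowestRep_eq_some {s : State P D} {ℓ : ℕ} {r : Fin P.n}
    (h : lowestRep s ℓ = some r) : ∃ ℓ' : Fin P.K, ℓ ≤ ℓ' ∧ s.rep ℓ' = some r := by
  obtain ⟨ℓ', hmem, hr⟩ := List.exists_of_findSome?_eq_some h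
  exact ⟨ℓ', by simpa using (List.mem_filter.1 hmem).2, hr⟩

lemma filled_of_refreshLevel_lt {s : State P D} {ℓ : ℕ} (hℓ : ℓ < P.K)
    (h : refreshLevel s < ℓ) : Filled s.stored s.height ℓ := by
  classical
  by_contra hcon
  have : ℓ ≤ refreshLevel s :=
    (Finset.le_sup (f := id) (Finset.mem_filter.2 ⟨Finset.mem_range.2 hℓ, hcon⟩)).trans
      (le_max_left _ _)
  omega

variable [LinearOrder D]

/-- The situation before a REFRESH: the state `s` after the previous round was sound, and the
heights drawn in the UPDATEs of the nodes of `V` since then are sparse and tall. -/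
structure Pending (x : ℝ) (v : ℕ) (F : Finset (Fin P.n → D)) (s : State P D)
    (V : Finset (Fin P.n)) (s' : State P D) : Prop where
  mult_le : (v : ℝ) ≤ P.L + 1
  item_mem : s.item ∈ F
  item_mem' : s'.item ∈ F
  injective : ∀ f ∈ F, Function.Injective f
  card_le : (F.card : ℝ) ≤ P.L + 1
  sound : Sound x v F s
  after : AfterUpdates s V s'
  sparse : SparseOn x F V s'.height
  tall : Tall x (fun _ => V) s'.height

variable {v : ℕ} {F : Finset (Fin P.n → D)} {s s' : State P D} {V : Finset (Fin P.n)}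

lemma Pending.sparse_univ (h : Pending x v F s V s') : SparseOn x F Finset.univ s'.height := by
  intro f hf m hm i _ hr
  by_cases hi : i ∈ V
  · exact h.sparse f hf m hm i hi hr
  · rw [h.after.height_eq i hi]
    exact h.sound.sparse f hf m hm i (Finset.mem_univ i) hr

/-- Stored nodes of lower classes have smaller items than stored nodes of higher classes: this holds
for the ranks in the previous sound state, and neither node has been updated since. -/
lemma Pending.item_lt (hP : P.Large x) (h : Pending x v F s V s') {ℓ m : ℕ} (hℓ : ℓ + 2 ≤ P.K)
    (hm : m < 8 * P.K) (hℓm : 8 * (ℓ + 1) + 3 ≤ m) {j k : Fin P.n} (hj : j ∈ s'.stored)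
    (hk : k ∈ s'.stored) (hjh : ((s'.height j : ℕ) : ℝ) ≤ P.thr (8 * (ℓ + 1)))
    (hkh : P.thr m < ((s'.height k : ℕ) : ℝ)) : s'.item j < s'.item k := by
  have hj' := h.after.stored j hj
  have hk' := h.after.stored k hk
  rw [h.after.item_eq j hj'.2, h.after.item_eq k hk'.2]
  rw [h.after.height_eq j hj'.2] at hjh
  rw [h.after.height_eq k hk'.2] at hkh
  have h1 : (rank s.item j : ℝ) ≤ v * P.size x (8 * (ℓ + 1)) := by
    exact_mod_cast h.sound.rank_le ℓ hℓ j hj'.1 hjh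
  have h2 : P.L ^ (m * P.con - x) < rank s.item k := by
    by_contra hcon
    exact absurd (h.sound.sparse _ h.item_mem m hm k (Finset.mem_univ k) (not_lt.1 hcon))
      (not_le.2 hkh)
  have h3 : P.L ^ ((8 * (ℓ + 1) + 3 : ℕ) * P.con - x) ≤ P.L ^ (m * P.con - x) := by
    refine hP.rpow_le_rpow (sub_le_sub_right (mul_le_mul_of_nonneg_right ?_ hP.con_pos.le) x)
    exact_mod_cast hℓm
  refine lt_of_rank_lt_rank (item := s.item) ?_
  exact_mod_cast h1.trans_lt ((hP.mul_size_lt h.mult_le _).trans_le (h3.trans h2.le))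

/-- If the level determined by REFRESH is at most `ℓ` then only few nodes have been updated. -/
lemma Pending.card_le_size (hP : P.Large x) (h : Pending x v F s V s') {ℓ : ℕ}
    (hℓ : ℓ + 2 ≤ P.K) (hlevel : refreshLevel s' ≤ ℓ) : V.card ≤ P.size x (8 * (ℓ + 1)) := by
  by_contra hcon
  obtain ⟨i, hi, hlt⟩ := h.tall (8 * (ℓ + 1)) (by omega) (not_le.1 hcon).le
  have h1 : (s'.height i : ℕ) ≤ s'.touched.sup fun i => (s'.height i : ℕ) :=
    Finset.le_sup (f := fun i => (s'.height i : ℕ)) (h.after.touched i (Or.inl hi))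
  have h2 : P.thr (8 * (ℓ + 1)) < ((s'.touched.sup fun i => (s'.height i : ℕ) : ℕ) : ℝ) :=
    hlt.trans_le (by exact_mod_cast h1)
  have h3 := hP.lt_levelOfHeight h2
  have h4 : P.levelOfHeight (s'.touched.sup fun i => (s'.height i : ℕ)) ≤ refreshLevel s' :=
    le_max_right _ _
  omega

lemma ready_univ (hP : P.Large x) (hv : 1 ≤ v) (hitem : s.item ∈ F)
    (hF : ∀ f ∈ F, Function.Injective f) (hcard : (F.card : ℝ) ≤ P.L + 1) (hs : RepStored s) :
    Ready x v F s Finset.univ where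
  item_mem := hitem
  injective := hF
  card_le := hcard
  initial _ _ j _ := Finset.mem_univ j
  sparse _ _ _ _ i hi := absurd (Finset.mem_univ i) hi
  one_le := hv
  rank_le _ _ j _ hj := absurd (Finset.mem_univ j) hj
  fill ℓ hℓ τ hτ := Or.inl <| by
    rw [Finset.card_univ, Fintype.card_fin]
    exact hP.size_le_n (by omega)
  repStored := hs

lemma Pending.ready (hP : P.Large x) (h : Pending x v F s V s') :
    Ready x (v + 1) F s' (refreshNodes s') := by
  classical
  have hstored := h.after.repStored h.sound.repStored
  rw [refreshNodes]
  cases hlow : lowestRep s' (refreshLevel s') with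
  | none =>
    exact ready_univ hP (Nat.le_add_left 1 v) h.item_mem' h.injective h.card_le hstored
  | some r =>
    obtain ⟨ℓ', hle, hrep⟩ := exists_of_lowestRep_eq_some hlow
    dsimp only
    set A : Finset (Fin P.n) := Finset.univ.filter fun i => s'.item i < s'.item r with hA
    have memA : ∀ i, i ∈ A ↔ s'.item i < s'.item r := fun i => by simp [hA]
    have hK := ℓ'.2
    obtain ⟨hrs, hrh⟩ := mem_sub.1 (hstored ℓ' r hrep)
    rw [Params.inSub_iff] at hrh
    have hinj := h.injective _ h.item_mem'
    -- only the item of `r` is missing from `A` among those up to `r`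
    have hrank : rank s'.item r ≤ A.card + 1 := by
      refine (Finset.card_le_card fun j hj => ?_).trans (Finset.card_insert_le r A)
      simp only [Finset.mem_filter, Finset.mem_univ, true_and] at hj
      rw [Finset.mem_insert, memA]
      exact (eq_or_lt_of_le hj).imp (fun e => hinj e) id
    refine ⟨h.item_mem', h.injective, h.card_le, ?_, ?_, Nat.le_add_left 1 v, ?_, ?_, hstored⟩
    · intro i hi j hji
      rw [memA] at hi ⊢
      exact hji.trans_lt hi
    · exact fun f hf m hm i _ => h.sparse_univ f hf m hm i (Finset.mem_univ i)
    · intro ℓ hℓ j hj hjA hjh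
      rw [memA, not_lt] at hjA
      rcases Nat.lt_or_ge ℓ ℓ' with hlt | hge
      · exact absurd (h.item_lt hP hℓ (m := 8 * ℓ' + 2 * 2 + 1) (by omega) (by omega) hj hrs hjh
          hrh.1) (not_lt.2 hjA)
      · have hj' := h.after.stored j hj
        have hV := h.card_le_size hP hℓ (hle.trans hge)
        rw [h.after.height_eq j hj'.2] at hjh
        calc rank s'.item j ≤ rank s.item j + V.card := rank_le_add_card h.after.item_eq hj'.2
          _ ≤ v * P.size x (8 * (ℓ + 1)) + P.size x (8 * (ℓ + 1)) :=
            add_le_add (h.sound.rank_le ℓ hℓ j hj'.1 hjh) hV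
          _ = (v + 1) * P.size x (8 * (ℓ + 1)) := by ring
    · intro ℓ hℓ τ hτ
      rcases Nat.lt_or_ge ℓ' ℓ with hlt | hge
      · -- classes above `ℓ'` are filled by nodes with items larger than that of `r`
        right
        have hfilled := filled_of_refreshLevel_lt hℓ (hle.trans_lt hlt)
        obtain ⟨j, hj⟩ : (sub s'.stored s'.height ℓ τ).Nonempty := by
          rcases hτ with rfl | rfl
          exacts [hfilled.1, hfilled.2]
        obtain ⟨hjs, hjh⟩ := mem_sub.1 hj
        refine ⟨j, hjs, ?_, hjh⟩
        rw [memA, not_lt]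
        rw [Params.inSub_iff] at hjh
        exact (h.item_lt hP (ℓ := ℓ') (by omega) (by omega) (by omega) hrs hjs
          (hrh.2.trans (hP.thr_le_thr (by omega))) hjh.1).le
      · rcases (by omega : (ℓ = ℓ' ∧ τ = 2) ∨ 8 * ℓ + 2 * τ + 1 ≤ 8 * ℓ' + 2 * 1 + 1)
          with ⟨rfl, rfl⟩ | hm
        · exact Or.inr ⟨r, hrs, by simp [memA], Params.inSub_iff.2 hrh⟩
        · -- `r` is high, so that its rank is large and `A` has many nodes
          left
          have h1 : P.L ^ ((8 * ℓ' + 2 * 2 + 1 : ℕ) * P.con - x) < rank s'.item r := by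
            by_contra hcon
            exact absurd (h.sparse_univ _ h.item_mem' _ (by omega) r (Finset.mem_univ r)
              (not_lt.1 hcon)) (not_le.2 hrh.1)
          have h2 : (P.size x (8 * ℓ + 2 * τ + 1) : ℝ)
              ≤ P.L ^ ((8 * ℓ' + 2 * 2 + 1 : ℕ) * P.con - x) := by
            refine (hP.size_le_rpow _).trans (hP.rpow_le_rpow
              (sub_le_sub_right (mul_le_mul_of_nonneg_right ?_ hP.con_pos.le) x))
            have : 8 * ℓ + 2 * τ + 1 + 2 ≤ 8 * (ℓ' : ℕ) + 2 * 2 + 1 := by omega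
            exact_mod_cast this
          have h3 : P.size x (8 * ℓ + 2 * τ + 1) < rank s'.item r := by
            exact_mod_cast h2.trans_lt h1
          omega

/-! ### All rounds -/

/-- Soundness at the end of the execution, when there are no future items. The multiplicity `v`
grows by one in each round. -/
def FinallySound (x : ℝ) (s : State P D) : Prop :=
  ∃ v : ℕ, (v : ℝ) ≤ P.L + 1 ∧ Function.Injective s.item ∧ Sound x v {s.item} s

lemma Sound.mono {F' : Finset (Fin P.n → D)} (h : Sound x v F s) (hF : F' ⊆ F) :
    Sound x v F' s :=
  ⟨fun f hf => h.sparse f (hF hf), h.rank_le, h.repStored, h.exists_rep⟩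

/-- `toOuterMeasure_bind_le` for procedures that may not terminate; this counts as a failure. -/
lemma andThen_fail_le {α β : Type*} (p : PMF (Option α)) (f : α → PMF (Option β)) (G : Set α)
    (S : Set (Option β)) {ε₁ ε₂ : ℝ≥0∞} (h₁ : p.toOuterMeasure {o | ∃ a, o = some a ∧ a ∈ G}ᶜ ≤ ε₁)
    (h₂ : ∀ a ∈ G, (f a).toOuterMeasure S ≤ ε₂) :
    (andThen p f).toOuterMeasure S ≤ ε₁ + ε₂ := by
  refine toOuterMeasure_bind_le _ _ {o | ∃ a, o = some a ∧ a ∈ G} _ h₁ ?_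
  rintro o - ⟨a, rfl, ha⟩
  exact h₂ a ha

lemma round_fail_le (hP : P.Large x) (hv : (v : ℝ) ≤ P.L + 1) (us : List (Fin P.n × D))
    (hF : ∀ f ∈ F, Function.Injective f) (hcard : (F.card : ℝ) ≤ P.L + 1)
    (hitem : s.item ∈ F) (hitem' : itemsAfter s.item us ∈ F) (hs : Sound x v F s) :
    ((updates s us).bind refresh).toOuterMeasure
      {o | ∃ s', o = some s' ∧ s' ∈ {s' | s'.item = itemsAfter s.item us ∧ Sound x (v + 1) F s'}}ᶜ
      ≤ 3 * ENNReal.ofReal (P.err x) := by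
  rw [show (3 : ℝ≥0∞) = 1 + 2 by norm_num, add_mul, one_mul]
  have hfresh := fresh_fail_le hP (freshOn_updates hP s us) hF hcard
    (C := fun _ => updated us) fun _ => subset_rfl
  rw [PMF.toOuterMeasure_map_apply] at hfresh
  refine toOuterMeasure_bind_le _ _ (State.height ⁻¹' {g | SparseOn x F (updated us) g ∧
    Tall x (fun _ => updated us) g}) _ hfresh ?_
  intro s' hs' hmem
  obtain ⟨h1, h2⟩ := afterUpdates_updates hP hs'
  have hpend : Pending x v F s (updated us) s' :=
    ⟨hv, hitem, h1 ▸ hitem', hF, hcard, hs, h2, hmem.1, hmem.2⟩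
  rw [← h1]
  exact initOn_fail_le hP (hpend.ready hP)

lemma rounds_fail_le (hP : P.Large x) (us : List (List (Fin P.n × D))) :
    ∀ (s : State P D) (v : ℕ), (v : ℝ) + us.length ≤ P.L + 1 → 1 ≤ v →
      (∀ f ∈ futures s.item us, Function.Injective f) → Sound x v (futures s.item us) s →
      (rounds s us).toOuterMeasure {o | ∃ s', o = some s' ∧ FinallySound x s'}ᶜ
        ≤ us.length * (3 * ENNReal.ofReal (P.err x)) := by
  classical
  induction us with
  | nil =>
    intro s v hv _ hF hs
    refine le_of_eq_of_le (toOuterMeasure_eq_zero_of_support _ fun o ho hbad => hbad ?_) zero_le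
    rw [rounds, PMF.support_pure, Set.mem_singleton_iff] at ho
    exact ⟨s, ho, v, by simpa using hv, hF _ (mem_futures _ _), hs⟩
  | cons us rest ih =>
    intro s v hv hv1 hF hs
    have hv' : (v : ℝ) + (rest.length + 1) ≤ P.L + 1 := by simpa using hv
    have hv1' : (1 : ℝ) ≤ v := by exact_mod_cast hv1
    have hlen : (0 : ℝ) ≤ rest.length := Nat.cast_nonneg _
    have hcard : ((futures s.item (us :: rest)).card : ℝ) ≤ P.L + 1 := by
      have := card_futures_le s.item (us :: rest)
      rw [List.length_cons] at this
      have : ((futures s.item (us :: rest)).card : ℝ) ≤ rest.length + 1 + 1 := by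
        exact_mod_cast this
      linarith
    have hsub : futures (itemsAfter s.item us) rest ⊆ futures s.item (us :: rest) :=
      Finset.subset_insert _ _
    rw [rounds, List.length_cons, Nat.cast_add, Nat.cast_one, add_comm (rest.length : ℝ≥0∞),
      add_mul, one_mul]
    refine andThen_fail_le _ _ _ _ (round_fail_le hP (v := v) (by linarith) us hF hcard
      (mem_futures _ _) (hsub (mem_futures _ _)) hs) ?_
    rintro s' ⟨hitem, hs'⟩
    refine ih s' (v + 1) (by push_cast; linarith) (by omega) ?_ ?_
    · rw [hitem]; exact fun f hf => hF f (hsub hf)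
    · rw [hitem]; exact hs'.mono hsub

lemma run_fail_le (hP : P.Large x) (item : Fin P.n → D) (us : List (List (Fin P.n × D)))
    (hdist : AlwaysDistinct item us) (hlen : (us.length : ℝ) ≤ P.L) :
    (run item us).toOuterMeasure {o | ∃ s, o = some s ∧ FinallySound x s}ᶜ
      ≤ ENNReal.ofReal (P.L ^ (4 - x)) := by
  have hF := injective_of_mem_futures hdist
  have hcard : ((futures item us).card : ℝ) ≤ P.L + 1 := by
    have : ((futures item us).card : ℝ) ≤ us.length + 1 := by
      exact_mod_cast card_futures_le item us
    linarith
  have hinit := initOn_fail_le hP (ready_univ (v := 1) (s := ⟨item, fun _ => 0, ∅, fun _ => none,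
    fun _ => none, ∅⟩) hP le_rfl (mem_futures item us) hF hcard fun ℓ r hr => by simp at hr)
  have hall := andThen_fail_le _ (fun s => rounds s us) {s | s.item = item ∧
    Sound x 1 (futures item us) s} {o | ∃ s, o = some s ∧ FinallySound x s}ᶜ hinit
    fun s hs => rounds_fail_le hP us s 1 (by push_cast; linarith) le_rfl (hs.1.symm ▸ hF)
      (hs.1.symm ▸ hs.2)
  refine hall.trans ?_
  have herr := hP.err_nonneg
  calc 2 * ENNReal.ofReal (P.err x) + us.length * (3 * ENNReal.ofReal (P.err x))
      = ENNReal.ofReal (2 * P.err x + us.length * (3 * P.err x)) := by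
        rw [ENNReal.ofReal_add (by positivity) (by positivity), ENNReal.ofReal_mul (by norm_num),
          ENNReal.ofReal_mul (Nat.cast_nonneg _), ENNReal.ofReal_mul (by norm_num),
          ENNReal.ofReal_natCast, ENNReal.ofReal_ofNat, ENNReal.ofReal_ofNat]
    _ ≤ ENNReal.ofReal (P.L ^ (4 - x)) := by
        refine ENNReal.ofReal_le_ofReal ?_
        have hL := hP.L_ge
        have hpos : 0 ≤ P.L ^ (2 - x) := Real.rpow_nonneg hP.L_pos.le _
        calc 2 * P.err x + us.length * (3 * P.err x)
            ≤ 2 * P.err x + P.L * (3 * P.err x) := by gcongr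
          _ ≤ 6 * P.L * P.err x := by nlinarith
          _ = 18 * P.L * P.L ^ (2 - x) * (1 / P.φ) := by rw [Params.err]; ring
          _ ≤ 18 * P.L * P.L ^ (2 - x) * (P.L / 18) := by
              refine mul_le_mul_of_nonneg_left hP.inv_φ_le (mul_nonneg ?_ hpos)
              linarith
          _ = P.L ^ 2 * P.L ^ (2 - x) := by ring
          _ = P.L ^ (4 - x) := by
              rw [← Real.rpow_two, ← Real.rpow_add hP.L_pos]; ring_nf

/-! ### Ranks of the representatives -/

lemma exists_rankInClass (hP : P.Large x) {k : ℕ} (hk : 1 ≤ k) : ∃ ℓ, P.RankInClass ℓ k := by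
  have hk' : (0 : ℝ) < k := by exact_mod_cast hk
  have hlog : 0 < Real.log P.L := Real.log_pos hP.one_lt_L
  have hc : 0 < 8 * P.con := by linarith [hP.con_pos]
  have hnonneg : 0 ≤ Real.logb P.L k / (8 * P.con) :=
    div_nonneg (Real.logb_nonneg hP.one_lt_L (by exact_mod_cast hk)) hc.le
  refine ⟨⌊Real.logb P.L k / (8 * P.con)⌋₊, ?_, ?_⟩
  · rw [← Real.le_logb_iff_rpow_le hP.one_lt_L hk']
    have := Nat.floor_le hnonneg
    rw [le_div_iff₀ hc] at this
    linarith
  · rw [← Real.logb_lt_iff_lt_rpow hP.one_lt_L hk']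
    have := Nat.lt_floor_add_one (Real.logb P.L k / (8 * P.con))
    rw [div_lt_iff₀ hc] at this
    linarith

lemma class_add_three_le (hP : P.Large x) {k ℓ : ℕ} (hℓ : P.RankInClass ℓ k)
    (hk : (k : ℝ) * P.L ^ (24 * P.con) ≤ P.n) : ℓ + 3 ≤ P.K := by
  have hpos : 0 < 8 * P.con * Real.logb 2 P.L :=
    mul_pos (mul_pos (by norm_num) hP.con_pos) (by linarith [hP.logb_L_ge_one])
  refine Nat.le_floor ?_
  rw [le_div_iff₀ hpos]
  have h1 : P.L ^ (8 * P.con * ℓ + 24 * P.con) ≤ P.n := by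
    rw [Real.rpow_add hP.L_pos]
    exact (mul_le_mul_of_nonneg_right hℓ.1 (Real.rpow_nonneg hP.L_pos.le _)).trans hk
  have h2 := Real.logb_le_logb_of_le (b := 2) (by norm_num) (Real.rpow_pos_of_pos hP.L_pos _) h1
  rw [Real.logb_rpow_eq_mul_logb_of_pos hP.L_pos] at h2
  rw [Params.L] at h2 ⊢
  push_cast
  linarith

/-- In a sound state the representative of class `ℓ + 1` answers queries of class `ℓ`: its rank is
between `log^{(8 (ℓ + 1) + 5) con - x} n` and `log^{8 (ℓ + 2) con + O(x)} n`. -/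
lemma FinallySound.roughRankSketch (hP : P.Large x) {s : State P D} (hs : FinallySound x s) :
    RoughRankSketch s (24 * P.con) := by
  obtain ⟨v, hv, hinj, hs⟩ := hs
  intro k hk hkn
  obtain ⟨ℓ, hℓ⟩ := exists_rankInClass hP hk
  have hK := class_add_three_le hP hℓ hkn
  obtain ⟨r, hr⟩ := hs.exists_rep ⟨ℓ + 1, by omega⟩
  obtain ⟨hrs, hrh⟩ := mem_sub.1 (hs.repStored _ r hr)
  rw [Params.inSub_iff] at hrh
  refine ⟨r, hrs, ⟨ℓ, _, hℓ, rfl, hr⟩, ?_, ?_⟩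
  · have h1 : P.L ^ ((8 * (ℓ + 1) + 2 * 2 + 1 : ℕ) * P.con - x) < rank s.item r := by
      by_contra hcon
      exact absurd (hs.sparse _ (Finset.mem_singleton_self _) _ (by omega) r (Finset.mem_univ r)
        (not_lt.1 hcon)) (not_le.2 hrh.1)
    have h2 : P.L ^ (8 * P.con * (ℓ + 1)) ≤ P.L ^ ((8 * (ℓ + 1) + 2 * 2 + 1 : ℕ) * P.con - x) := by
      refine hP.rpow_le_rpow ?_
      push_cast
      linarith [hP.con_ge, hP.four_le]
    exact_mod_cast (hℓ.2.trans_le (h2.trans h1.le)).le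
  · have h1 : (rank s.item r : ℝ) ≤ v * P.size x (8 * (ℓ + 1 + 1)) := by
      exact_mod_cast hs.rank_le (ℓ + 1) (by omega) r hrs
        (hrh.2.trans (hP.thr_le_thr (by dsimp only; omega)))
    calc (rank s.item r : ℝ) ≤ P.L ^ ((8 * (ℓ + 1 + 1) + 3 : ℕ) * P.con - x) :=
          h1.trans (hP.mul_size_lt hv _).le
      _ ≤ P.L ^ (8 * P.con * ℓ + 24 * P.con) := by
          refine hP.rpow_le_rpow ?_
          push_cast
          linarith [hP.con_ge, hP.four_le]
      _ = P.L ^ (8 * P.con * ℓ) * P.L ^ (24 * P.con) := Real.rpow_add hP.L_pos _ _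
      _ ≤ k * P.L ^ (24 * P.con) :=
          mul_le_mul_of_nonneg_right hℓ.1 (Real.rpow_nonneg hP.L_pos.le _)

end Refresh

end

end SeleMon

theorem mainTheorem8 :
    ∀ c' : ℝ, 0 < c' → ∃ con₀ : ℝ, 0 < con₀ ∧ ∀ con : ℝ, con₀ ≤ con →
      ∃ c : ℝ, 0 < c ∧ ∀ (φ : ℝ) (hφ₀ : 0 < φ) (hφ₁ : φ < 1), ∃ n₀ : ℕ, ∀ n : ℕ, n₀ ≤ n →
        ∀ (D : Type u) [LinearOrder D] (item : Fin n → D) (us : List (List (Fin n × D))),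
          SeleMon.AlwaysDistinct item us → (us.length : ℝ) ≤ Real.logb 2 n →
          ENNReal.ofReal (1 - Real.logb 2 n ^ (-c')) ≤
            (SeleMon.run (P := ⟨n, φ, hφ₀, hφ₁, con⟩) item us).toOuterMeasure
              {o | ∃ s, o = some s ∧ SeleMon.RoughRankSketch s c} := by
  intro c' hc'
  -- the safety margins are `log^x n` for `x = c' + 4`, and `con` has to be at least `x + 2`; the
  -- failure probability is `log^{4 - x} n`
  refine ⟨c' + 6, by linarith, fun con hcon => ⟨24 * con, by linarith, fun φ hφ₀ hφ₁ => ?_⟩⟩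
  refine ⟨⌈(2 : ℝ) ^ max 4 (18 / φ)⌉₊, fun n hn D _ item us hdist hlen => ?_⟩
  have hL : max 4 (18 / φ) ≤ Real.logb 2 n := by
    have h2 : (2 : ℝ) ^ max 4 (18 / φ) ≤ n := (Nat.le_ceil _).trans (by exact_mod_cast hn)
    have hn0 : (0 : ℝ) < n := (Real.rpow_pos_of_pos (by norm_num) _).trans_le h2
    rwa [Real.le_logb_iff_rpow_le (by norm_num) hn0]
  set P : SeleMon.Params := ⟨n, φ, hφ₀, hφ₁, con⟩ with hPdef
  have hP : P.Large (c' + 4) :=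
    { four_le := by linarith
      con_ge := by change c' + 4 + 2 ≤ con; linarith
      L_ge := (le_max_left _ _).trans hL
      L_φ := (div_le_iff₀ hφ₀).1 ((le_max_right _ _).trans hL) }
  have hfail := SeleMon.run_fail_le hP item us hdist hlen
  rw [show 4 - (c' + 4) = -c' by ring] at hfail
  set p := SeleMon.run (P := P) item us with hp
  have hsub : p.toOuterMeasure {o | ∃ s, o = some s ∧ SeleMon.FinallySound (c' + 4) s}
      ≤ p.toOuterMeasure {o | ∃ s, o = some s ∧ SeleMon.RoughRankSketch s (24 * con)} :=
    MeasureTheory.measure_mono fun o ⟨s, ho, hs⟩ => ⟨s, ho, hs.roughRankSketch hP⟩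
  refine le_trans ?_ hsub
  have hpos : 0 ≤ Real.logb 2 n ^ (-c') := Real.rpow_nonneg hP.L_pos.le _
  rw [ENNReal.ofReal_sub _ hpos, ENNReal.ofReal_one, tsub_le_iff_right,
    ← SeleMon.toOuterMeasure_add_compl p]
  exact add_le_add_right hfail _
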